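/- Let $m\ge 1$, and for $1\le j\le m$ let $p_{j,\lambda}(y)$ be a polynomial in $y$ of degree $d_j\ge 2$ whose coefficients are complex polynomials in $\lambda$ and whose highest degree coefficient $c_j\ne 0$ does not depend on $\lambda$; let $\delta_j\in\mathbb C\setminus\{0\}$ and $c\in\mathbb C\setminus\{0\}$. Put $H_{j,\lambda}(x,y)=(y,\,p_{j,\lambda}(y)-\delta_j x)$, $H_\lambda=H_{m,\lambda}\circ\cdots\circ H_{1,\lambda}$, and let $$H(\lambda,x,y)=(c\lambda,\,H_\lambda(x,y))$$ be the corresponding skew product of Hénon maps, a polynomial automorphism of $\mathbb C^3$. Let $d=d_1\cdots d_m$, and let $\tilde d=\deg H$ be the largest total degree, in the variables $(\lambda,x,y)$, of the components of $H$. For $R>0$ put $$V_R^+=\begin{cases}\{|y|>\max\{R,|x|,|\lambda|^{\tilde d+1}\}\}, & |c|\ge 1,\\ \{|y|>\max\{R,|x|\},\ |\lambda|<1\}, & |c|<1,\end{cases}\qquad V_R^-=\begin{cases}\{|x|>\max\{R,|y|,|\lambda|^{\tilde d+1}\}\}, & |c|\le 1,\\ \{|x|>\max\{R,|y|\},\ |\lambda|<1\},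 & |c|> 1,\end{cases}$$ and $U_H^\pm=\bigcup_{n\ge1}H^{\mp n}(V_R^\pm)$, $K_H^\pm=\mathbb C^3\setminus U_H^\pm$. For $n\ge 1$ let $$G_{n,H}^\pm(\lambda,x,y)=\frac1{\tilde d\,d^{\,n-1}}\log^+\|H^{\pm n}(\lambda,x,y)\|,$$ where $\|\cdot\|$ is the Euclidean norm on $\mathbb C^3$, and let $G_H^\pm=\lim_{n\to\infty}G_{n,H}^\pm$. Then there is $R_0$, depending on $H$, such that for all $R\ge R_0$ the following hold. The limits $G_H^\pm$ exist, and $G_{n,H}^\pm\to G_H^\pm$ uniformly on compact subsets of $\mathbb C^3$. The functions $G_H^\pm$ are plurisubharmonic on $\mathbb C^3$, the sets $\mathbb C^3\setminus K_H^\pm$ are open, and $G_H^\pm$ is pluriharmonic on $\mathbb C^3\setminus K_H^\pm$. Moreover $$G_H^\pm\circ H^{\pm1}=d\,G_H^\pm\quad\text{on }\mathbb C^3,$$ $G_H^\pm>0$ on $U_H^\pm$, and $G_H^\pm(\lambda,x,y)=0$ if and only if $(\lambda,x,y)\in K_H^\pm$. -/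

import Mathlib

open Polynomial Filter Topology

noncomputable section

/-- A family, depending on a parameter `l`, of generalized Hénon maps
`(x, y) ↦ (y, p_l(y) - δ x)` of `ℂ²`. The polynomial `p_l(y)` of degree `≥ 2` in `y` is given as an
element of `ℂ[l][y]`; its degree, its highest degree coefficient and `δ` do not depend on `l`. -/
structure HenonFactor where
  p : ℂ[X][X]
  δ : ℂ
  δ_ne_zero : δ ≠ 0
  two_le_natDegree : 2 ≤ p.natDegree
  leadingCoeff_const : ∃ a : ℂ, a ≠ 0 ∧ p.leadingCoeff = C a

namespace HenonFactor

/-- The map `(x, y) ↦ (y, p_l(y) - δ x)`, for `l, x, y` in a commutative `ℂ`-algebra. It is used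
for complex numbers and for indeterminates. -/
def map {S : Type} [CommRing S] [Algebra ℂ S] (f : HenonFactor) (l : S) (z : S × S) : S × S :=
  (z.2, f.p.eval₂ (aeval l : ℂ[X] →ₐ[ℂ] S).toRingHom z.2 - algebraMap ℂ S f.δ * z.1)

/-- The inverse `(x, y) ↦ (δ⁻¹ (p_l(x) - y), x)`. -/
def invMap (f : HenonFactor) (l : ℂ) (z : ℂ × ℂ) : ℂ × ℂ :=
  (f.δ⁻¹ * (f.p.eval₂ (aeval l : ℂ[X] →ₐ[ℂ] ℂ).toRingHom z.1 - z.2), z.1)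

theorem invMap_map (f : HenonFactor) (l : ℂ) (z : ℂ × ℂ) : f.invMap l (f.map l z) = z := by
  have := f.δ_ne_zero
  ext <;> simp [map, invMap, this]

theorem map_invMap (f : HenonFactor) (l : ℂ) (z : ℂ × ℂ) : f.map l (f.invMap l z) = z := by
  have := f.δ_ne_zero
  ext <;> simp [map, invMap, this]

end HenonFactor

/-- A skew product of Hénon maps `H(l, x, y) = (c l, H_l(x, y))` of `ℂ³`, where
`H_l = H_{m,l} ∘ ⋯ ∘ H_{1,l}`. The list of factors is `[H_1, …, H_m]`, `m ≥ 1`. -/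
structure SkewHenon where
  c : ℂ
  c_ne_zero : c ≠ 0
  factors : List HenonFactor
  factors_ne_nil : factors ≠ []

namespace SkewHenon

/-- `H_l(x, y)`, for `l, x, y` in a commutative `ℂ`-algebra. -/
def fiberMap {S : Type} [CommRing S] [Algebra ℂ S] (H : SkewHenon) (l : S) (z : S × S) : S × S :=
  H.factors.foldl (fun w f => f.map l w) z

/-- `H_l⁻¹ = H_{1,l}⁻¹ ∘ ⋯ ∘ H_{m,l}⁻¹`. -/
def fiberInvMap (H : SkewHenon) (l : ℂ) (z : ℂ × ℂ) : ℂ × ℂ :=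
  H.factors.foldr (fun f w => f.invMap l w) z

theorem fiberInvMap_fiberMap (H : SkewHenon) (l : ℂ) (z : ℂ × ℂ) :
    H.fiberInvMap l (H.fiberMap l z) = z := by
  unfold fiberInvMap fiberMap
  induction H.factors generalizing z with
  | nil => rfl
  | cons f L ih => simp [ih, f.invMap_map]

theorem fiberMap_fiberInvMap (H : SkewHenon) (l : ℂ) (z : ℂ × ℂ) :
    H.fiberMap l (H.fiberInvMap l z) = z := by
  unfold fiberInvMap fiberMap
  induction H.factors with
  | nil => rfl
  | cons f L ih => simp [ih, f.map_invMap]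

/-- The automorphism `H(l, x, y) = (c l, H_l(x, y))` of `ℂ³`, with inverse
`H⁻¹(l, x, y) = (c⁻¹ l, H_{c⁻¹ l}⁻¹(x, y))`. -/
def toPerm (H : SkewHenon) : Equiv.Perm (ℂ × ℂ × ℂ) where
  toFun q := (H.c * q.1, H.fiberMap q.1 q.2)
  invFun q := (H.c⁻¹ * q.1, H.fiberInvMap (H.c⁻¹ * q.1) q.2)
  left_inv q := by
    simp [H.c_ne_zero, fiberInvMap_fiberMap]
  right_inv q := by
    simp [H.c_ne_zero, fiberMap_fiberInvMap]

/-- `d = d_m ⋯ d_1`, the degree of `H_l` as a polynomial map of `ℂ²`. -/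
def fiberDegree (H : SkewHenon) : ℕ :=
  (H.factors.map fun f => f.p.natDegree).prod

/-- The last two components of `H`, as a pair of polynomials in the three indeterminates
`l, x, y`. -/
def polys (H : SkewHenon) : MvPolynomial (Fin 3) ℂ × MvPolynomial (Fin 3) ℂ :=
  H.fiberMap (MvPolynomial.X 0) (MvPolynomial.X 1, MvPolynomial.X 2)

/-- `d̃ = deg H`, the total degree of `H` as a polynomial map of `ℂ³`. (The first component `c l`
has degree `1` and does not affect the maximum.) -/
def totalDegree (H : SkewHenon) : ℕ :=
  max H.polys.1.totalDegree H.polys.2.totalDegree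

/-- The set `V_R^+`: `|y| > max {R, |x|, |l|^(d̃+1)}` for `|c| ≥ 1`, and
`|y| > max {R, |x|}`, `|l| < 1` for `|c| < 1`. -/
def VPlus (H : SkewHenon) (R : ℝ) : Set (ℂ × ℂ × ℂ) :=
  {q | if 1 ≤ ‖H.c‖ then max R (max ‖q.2.1‖ (‖q.1‖ ^ (H.totalDegree + 1))) < ‖q.2.2‖
    else max R ‖q.2.1‖ < ‖q.2.2‖ ∧ ‖q.1‖ < 1}

/-- The set `V_R^-`: `|x| > max {R, |y|, |l|^(d̃+1)}` for `|c| ≤ 1`, and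
`|x| > max {R, |y|}`, `|l| < 1` for `|c| > 1`. -/
def VMinus (H : SkewHenon) (R : ℝ) : Set (ℂ × ℂ × ℂ) :=
  {q | if ‖H.c‖ ≤ 1 then max R (max ‖q.2.2‖ (‖q.1‖ ^ (H.totalDegree + 1))) < ‖q.2.1‖
    else max R ‖q.2.2‖ < ‖q.2.1‖ ∧ ‖q.1‖ < 1}

/-- `U_H^+ = ⋃_{n ≥ 1} H^{-n}(V_R^+)`. -/
def UPlus (H : SkewHenon) (R : ℝ) : Set (ℂ × ℂ × ℂ) :=
  ⋃ n ∈ Set.Ici (1 : ℕ), (fun q => (H.toPerm⁻¹ ^ n) q) '' H.VPlus R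

/-- `U_H^- = ⋃_{n ≥ 1} H^n(V_R^-)`. -/
def UMinus (H : SkewHenon) (R : ℝ) : Set (ℂ × ℂ × ℂ) :=
  ⋃ n ∈ Set.Ici (1 : ℕ), (fun q => (H.toPerm ^ n) q) '' H.VMinus R

/-- `K_H^+ = ℂ³ \ U_H^+`. -/
def KPlus (H : SkewHenon) (R : ℝ) : Set (ℂ × ℂ × ℂ) := (H.UPlus R)ᶜ

/-- `K_H^- = ℂ³ \ U_H^-`. -/
def KMinus (H : SkewHenon) (R : ℝ) : Set (ℂ × ℂ × ℂ) := (H.UMinus R)ᶜ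

/-- The Euclidean norm on `ℂ³` (the norm instance of the product type is the maximum norm). -/
def euclideanNorm (q : ℂ × ℂ × ℂ) : ℝ :=
  √(‖q.1‖ ^ 2 + ‖q.2.1‖ ^ 2 + ‖q.2.2‖ ^ 2)

/-- `G_{n,H}^+ = (d̃ d^{n-1})⁻¹ log⁺ ‖H^n‖`, for `n ≥ 1`. -/
def greenSeqPlus (H : SkewHenon) (n : ℕ) (q : ℂ × ℂ × ℂ) : ℝ :=
  1 / ((H.totalDegree : ℝ) * (H.fiberDegree : ℝ) ^ (n - 1)) *
    Real.posLog (euclideanNorm ((H.toPerm ^ n) q))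

/-- `G_{n,H}^- = (d̃ d^{n-1})⁻¹ log⁺ ‖H^{-n}‖`, for `n ≥ 1`. -/
def greenSeqMinus (H : SkewHenon) (n : ℕ) (q : ℂ × ℂ × ℂ) : ℝ :=
  1 / ((H.totalDegree : ℝ) * (H.fiberDegree : ℝ) ^ (n - 1)) *
    Real.posLog (euclideanNorm ((H.toPerm⁻¹ ^ n) q))

/-- `G_H^+`, the pointwise limit of `G_{n,H}^+` as `n → ∞`. -/
def greenPlus (H : SkewHenon) (q : ℂ × ℂ × ℂ) : ℝ :=
  limUnder atTop fun n => H.greenSeqPlus n q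

/-- `G_H^-`, the pointwise limit of `G_{n,H}^-` as `n → ∞`. -/
def greenMinus (H : SkewHenon) (q : ℂ × ℂ × ℂ) : ℝ :=
  limUnder atTop fun n => H.greenSeqMinus n q

end SkewHenon

/-- Plurisubharmonicity of a real-valued function on an open subset `Ω` of `ℂ³`:
upper semicontinuity, and the submean inequality on every closed disc of a complex line that is
contained in `Ω`. For a function with finite values, an upper semicontinuous restriction to a
circle that satisfies the submean inequality has a finite integral, hence the integrability. -/
def IsPlurisubharmonicOn (u : ℂ × ℂ × ℂ → ℝ) (Ω : Set (ℂ × ℂ × ℂ)) : Prop :=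
  UpperSemicontinuousOn u Ω ∧
    ∀ a b : ℂ × ℂ × ℂ, (∀ ζ : ℂ, ‖ζ‖ ≤ 1 → a + ζ • b ∈ Ω) →
      CircleIntegrable (fun ζ : ℂ => u (a + ζ • b)) 0 1 ∧
        u a ≤ Real.circleAverage (fun ζ : ℂ => u (a + ζ • b)) 0 1

/-- Pluriharmonicity of a real-valued function on an open subset `Ω` of `ℂ³`:
`u` is of class `C²` (in the real sense), and its restriction to every complex line is harmonic. -/
def IsPluriharmonicOn (u : ℂ × ℂ × ℂ → ℝ) (Ω : Set (ℂ × ℂ × ℂ)) : Prop :=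
  ContDiffOn ℝ 2 u Ω ∧
    ∀ a ∈ Ω, ∀ b : ℂ × ℂ × ℂ, InnerProductSpace.HarmonicAt (fun ζ : ℂ => u (a + ζ • b)) 0

end

/-! Give the parameter weight `1` and each of `x`, `y` weight `d̃ + 1`. On a weighted polydisc of
size `ν`, the `y`-coordinate of `H` is `κ y ^ d` and the `x`-coordinate of `H⁻¹` is `κ' x ^ d`, with
`κ, κ' ≠ 0`, up to errors `O(ν ^ ((d̃ + 1) d - 1))`; the remaining fibre coordinate is itself such
an error. Everything dynamical follows from these estimates. They are collected in `EscapeSystem`,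
which is applied to `H`, and to `H⁻¹` with `x` and `y` exchanged.

For large `R` the region `V` is forward invariant, and there `log |y ∘ H| = d log |y|` plus the real
part of a bounded holomorphic function. A point outside `V` cannot have grown in a step except
through `R` or the parameter, because where `x` dominates `H⁻¹` expands `x`; hence `log⁺` of the
norm grows at most linearly before escape. In both regimes the increments of `d⁻ⁿ log⁺ ‖Hⁿ‖` are
`O((n + 1) / d ^ (n + 1))` uniformly on compact sets. This yields the uniform limit, its
plurisubharmonicity (each `log⁺ ‖Hⁿ‖` has the submean property) and its vanishing off `U`. On `V`
the limit is `log |y|` plus the real part of a holomorphic series, so it is pluriharmonic, and it is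
positive once `log R` exceeds the bound for the series. The functional equation carries both facts
to `U`.

The algebraic point is that `d̃` controls the weights. Coefficients of the single `p_j` may have
degree above `d̃` in the parameter, since they can cancel in the composition. Recentring the factors
along the orbit of the origin makes each of them fix the origin; then no cancellation occurs
(`natDegree_coeff_centered_le`), and the remaining translation has degree at most `d̃`. -/

noncomputable section

/-! ### Uniform limits of holomorphic functions of several variables -/

/-- Cauchy's estimate for the derivative of a bounded holomorphic function on a ball of a complex
normed space. -/
theorem norm_fderiv_le_of_forall_mem_ball_norm_le {E F : Type*} [NormedAddCommGroup E]
    [NormedSpace ℂ E] [NormedAddCommGroup F] [NormedSpace ℂ F] {f : E → F} {z : E} {r M : ℝ}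
    (hr : 0 < r) (hf : DifferentiableOn ℂ f (Metric.ball z r))
    (hM : ∀ w ∈ Metric.ball z r, ‖f w‖ ≤ M) : ‖fderiv ℂ f z‖ ≤ 2 * M / r := by
  refine Complex.norm_fderiv_le_div_of_mapsTo_ball hf (fun w hw => ?_) hr
  rw [Metric.mem_closedBall, dist_eq_norm]
  have h₁ := hM w hw
  have h₂ := hM z (Metric.mem_ball_self hr)
  linarith [norm_sub_le (f w) (f z)]

/-- Cauchy's estimate on half the ball bounds the derivatives by a summable sequence, so the series
may be differentiated termwise. The target `F` is quantified inside the induction because the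
derivatives take values in another space. -/
theorem contDiffAt_tsum_of_holomorphic {E : Type} [NormedAddCommGroup E] [NormedSpace ℂ E] (n : ℕ) :
    ∀ {F : Type} [NormedAddCommGroup F] [NormedSpace ℂ F] [CompleteSpace F] {f : ℕ → E → F}
      {u : ℕ → ℝ} {a : E} {r : ℝ}, 0 < r → Summable u →
      (∀ k, ContDiffOn ℂ (⊤ : ℕ∞) (f k) (Metric.ball a r)) →
      (∀ k, ∀ z ∈ Metric.ball a r, ‖f k z‖ ≤ u k) →
      ContDiffAt ℂ n (fun z => ∑' k, f k z) a := by
  induction n with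
  | zero =>
    intro F _ _ _ f u a r hr hu hf hfu
    have hc : ContinuousOn (fun z => ∑' k, f k z) (Metric.ball a r) :=
      continuousOn_tsum (fun k => (hf k).continuousOn) hu hfu
    exact contDiffAt_zero.2 ⟨_, Metric.ball_mem_nhds a hr, hc⟩
  | succ n ih =>
    intro F _ _ _ f u a r hr hu hf hfu
    have hsub : ∀ z ∈ Metric.ball a (r / 2), Metric.ball z (r / 2) ⊆ Metric.ball a r := by
      intro z hz
      refine Metric.ball_subset_ball' ?_
      have := Metric.mem_ball.1 hz
      linarith
    have hbound : ∀ k, ∀ z ∈ Metric.ball a (r / 2),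
        ‖fderiv ℂ (f k) z‖ ≤ 2 * u k / (r / 2) := fun k z hz =>
      norm_fderiv_le_of_forall_mem_ball_norm_le (half_pos hr)
        (((hf k).differentiableOn (by simp)).mono (hsub z hz))
        (fun w hw => hfu k w (hsub z hz hw))
    have hu' : Summable fun k => 2 * u k / (r / 2) := (hu.mul_left 2).div_const _
    have hball : Metric.ball a (r / 2) ⊆ Metric.ball a r :=
      Metric.ball_subset_ball (by linarith)
    have ha : a ∈ Metric.ball a (r / 2) := Metric.mem_ball_self (half_pos hr)
    have hconv : Convex ℝ (Metric.ball a (r / 2)) := by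
      let _ := NormedSpace.restrictScalars ℝ ℂ E
      exact convex_ball a (r / 2)
    push_cast
    rw [contDiffAt_succ_iff_hasFDerivAt]
    refine ⟨fun z => ∑' k, fderiv ℂ (f k) z, ⟨Metric.ball a (r / 2),
      Metric.ball_mem_nhds a (half_pos hr), fun z hz => ?_⟩, ?_⟩
    · refine hasFDerivAt_tsum_of_isPreconnected hu' Metric.isOpen_ball
        hconv.isPreconnected (fun k w hw => ?_) hbound ha ?_ hz
      · exact (((hf k).differentiableOn (by simp)).differentiableAt
          (Metric.isOpen_ball.mem_nhds (hball hw))).hasFDerivAt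
      · exact Summable.of_norm_bounded hu (fun k => hfu k a (hball ha))
    · refine ih (half_pos hr) hu' (fun k => ?_) hbound
      exact ((hf k).fderiv_of_isOpen Metric.isOpen_ball (by simp)).mono hball

/-! ### The submean inequality for `log⁺ ‖f‖` -/

/-- Jensen's formula: the zeros in the disc contribute nonnegative terms. -/
theorem log_norm_le_circleAverage_log_norm {f : ℂ → ℂ} (hf : Differentiable ℂ f) (h0 : f 0 ≠ 0) :
    Real.log ‖f 0‖ ≤ Real.circleAverage (fun z => Real.log ‖f z‖) 0 1 := by
  have han : AnalyticOnNhd ℂ f (Metric.closedBall 0 |(1 : ℝ)|) := fun z _ => hf.analyticAt z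
  rw [han.circleAverage_log_norm one_ne_zero h0]
  refine le_add_of_nonneg_left (finsum_nonneg fun u => ?_)
  by_cases hu : u ∈ Metric.closedBall (0 : ℂ) |(1 : ℝ)|
  · refine mul_nonneg (mod_cast MeromorphicOn.AnalyticOnNhd.divisor_nonneg han u) ?_
    have hu' : ‖u‖ ≤ 1 := by simpa using hu
    rcases eq_or_ne u 0 with rfl | hne
    · simp
    · simpa using Real.log_nonpos (norm_nonneg u) hu'
  · simp [Function.locallyFinsuppWithin.apply_eq_zero_of_notMem _ hu]

/-- The vector case reduces to the scalar one by pairing `f` with the fixed vector `f 0`. By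
Cauchy–Schwarz the pairing has `log` at most `log ‖f 0‖ + log⁺ ‖f z‖`, with `log ‖f 0‖ ^ 2` at the
centre. -/
theorem posLog_norm_le_circleAverage_posLog_norm {E : Type*} [NormedAddCommGroup E]
    [InnerProductSpace ℂ E] {f : ℂ → E} (hf : Differentiable ℂ f) :
    Real.posLog ‖f 0‖ ≤ Real.circleAverage (fun z => Real.posLog ‖f z‖) 0 1 := by
  have hcont : Continuous fun z => Real.posLog ‖f z‖ :=
    Real.continuous_posLog.comp hf.continuous.norm
  have hci : CircleIntegrable (fun z => Real.posLog ‖f z‖) 0 1 :=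
    hcont.continuousOn.circleIntegrable zero_le_one
  by_cases h1 : ‖f 0‖ ≤ 1
  · rw [(Real.posLog_eq_zero_iff _).2 (by rwa [abs_norm])]
    exact Real.circleAverage_nonneg_of_nonneg fun z _ => Real.posLog_nonneg
  · push Not at h1
    have hpos : 0 < ‖f 0‖ := by linarith
    set h : ℂ → ℂ := fun z => inner ℂ (f 0) (f z) with hh
    have hdiff : Differentiable ℂ h := (innerSL ℂ (f 0)).differentiable.comp hf
    have h0 : ‖h 0‖ = ‖f 0‖ * ‖f 0‖ := by
      simp [hh, inner_self_eq_norm_sq_to_K, sq]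
    have h0' : h 0 ≠ 0 := by
      rw [← norm_pos_iff, h0]; positivity
    have han : AnalyticOnNhd ℂ h (Metric.sphere 0 |(1 : ℝ)|) := fun z _ => hdiff.analyticAt z
    have key := log_norm_le_circleAverage_log_norm hdiff h0'
    have hle : Real.circleAverage (fun z => Real.log ‖h z‖) 0 1 ≤
        Real.circleAverage (fun z => Real.log ‖f 0‖ + Real.posLog ‖f z‖) 0 1 := by
      refine Real.circleAverage_mono han.meromorphicOn.circleIntegrable_log_norm
        ((continuous_const.add hcont).continuousOn.circleIntegrable zero_le_one) fun z _ => ?_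
      have hb : ‖h z‖ ≤ ‖f 0‖ * ‖f z‖ := norm_inner_le_norm _ _
      rcases (norm_nonneg (h z)).eq_or_lt with hz | hz
      -- At a zero of `h` the logarithm takes the value `0`, so `log ‖f 0‖ ≥ 0` is needed here.
      · rw [← hz, Real.log_zero]
        exact add_nonneg (Real.log_nonneg h1.le) Real.posLog_nonneg
      · have hfz : 0 < ‖f z‖ := pos_of_mul_pos_right (hz.trans_le hb) hpos.le
        calc Real.log ‖h z‖ ≤ Real.log (‖f 0‖ * ‖f z‖) := Real.log_le_log hz hb
          _ = Real.log ‖f 0‖ + Real.log ‖f z‖ := Real.log_mul hpos.ne' hfz.ne'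
          _ ≤ _ := by gcongr; exact le_max_right _ _
    have hadd : Real.circleAverage (fun z => Real.log ‖f 0‖ + Real.posLog ‖f z‖) 0 1 =
        Real.log ‖f 0‖ + Real.circleAverage (fun z => Real.posLog ‖f z‖) 0 1 := by
      have := Real.circleAverage_add (circleIntegrable_const (Real.log ‖f 0‖) 0 1) hci
      rw [Real.circleAverage_const] at this
      exact this
    rw [h0, Real.log_mul hpos.ne' hpos.ne'] at key
    rw [Real.posLog_eq_log (by rw [abs_norm]; exact h1.le)]
    linarith

/-! ### The Euclidean norm on `ℂ³` -/

theorem euclideanNorm_eq_norm (q : ℂ × ℂ × ℂ) :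
    SkewHenon.euclideanNorm q = ‖(!₂[q.1, q.2.1, q.2.2] : EuclideanSpace ℂ (Fin 3))‖ := by
  rw [EuclideanSpace.norm_eq, SkewHenon.euclideanNorm]
  simp [Fin.sum_univ_three]

theorem continuous_euclideanNorm : Continuous SkewHenon.euclideanNorm := by
  unfold SkewHenon.euclideanNorm
  fun_prop

theorem posLog_euclideanNorm_le_circleAverage {f : ℂ → ℂ × ℂ × ℂ} (hf : Differentiable ℂ f) :
    Real.posLog (SkewHenon.euclideanNorm (f 0)) ≤
      Real.circleAverage (fun z => Real.posLog (SkewHenon.euclideanNorm (f z))) 0 1 := by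
  simp only [euclideanNorm_eq_norm]
  refine posLog_norm_le_circleAverage_posLog_norm (f := fun z =>
    (!₂[(f z).1, (f z).2.1, (f z).2.2] : EuclideanSpace ℂ (Fin 3))) ?_
  rw [differentiable_euclidean]
  intro i
  fin_cases i <;> simp <;> fun_prop

/-- A locally uniform limit of continuous functions that satisfy the submean inequality is
plurisubharmonic. -/
theorem isPlurisubharmonicOn_univ_of_tendstoUniformlyOn {u : ℕ → ℂ × ℂ × ℂ → ℝ}
    {v : ℂ × ℂ × ℂ → ℝ} (hu : ∀ n, Continuous (u n))
    (hmean : ∀ n, ∀ a b : ℂ × ℂ × ℂ,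
      u n a ≤ Real.circleAverage (fun ζ : ℂ => u n (a + ζ • b)) 0 1)
    (hlim : ∀ Q : Set (ℂ × ℂ × ℂ), IsCompact Q → TendstoUniformlyOn u v atTop Q) :
    IsPlurisubharmonicOn v Set.univ := by
  have hv : Continuous v :=
    (tendstoLocallyUniformly_iff_forall_isCompact.2 hlim).continuous
      (Eventually.of_forall hu).frequently
  refine ⟨hv.continuousOn.upperSemicontinuousOn, fun a b _ => ?_⟩
  have hci : ∀ w : ℂ × ℂ × ℂ → ℝ, Continuous w →
      CircleIntegrable (fun ζ : ℂ => w (a + ζ • b)) 0 1 := fun w hw =>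
    (show Continuous fun ζ : ℂ => w (a + ζ • b) by fun_prop).continuousOn.circleIntegrable
      zero_le_one
  refine ⟨hci v hv, le_of_forall_pos_le_add fun ε hε => ?_⟩
  have hQ : IsCompact ((fun ζ : ℂ => a + ζ • b) '' Metric.closedBall 0 1) :=
    (isCompact_closedBall 0 1).image (by fun_prop)
  obtain ⟨n, hn⟩ := ((Metric.tendstoUniformlyOn_iff.1 (hlim _ hQ)) (ε / 2) (half_pos hε)).exists
  have hball : ∀ ζ : ℂ, ‖ζ‖ ≤ 1 → |v (a + ζ • b) - u n (a + ζ • b)| < ε / 2 := fun ζ hζ =>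
    hn _ ⟨ζ, by simpa using hζ, rfl⟩
  have h1 := abs_lt.1 (hball 0 (by simp))
  rw [zero_smul, add_zero] at h1
  have h2 : Real.circleAverage (fun ζ : ℂ => u n (a + ζ • b)) 0 1 ≤
      Real.circleAverage (fun ζ : ℂ => v (a + ζ • b) + ε / 2) 0 1 := by
    refine Real.circleAverage_mono (hci _ (hu n)) (hci (fun q => v q + ε / 2) (by fun_prop))
      fun ζ hζ => ?_
    have := abs_lt.1 (hball ζ (by simpa using (mem_sphere_zero_iff_norm.1 hζ).le))
    linarith
  have h3 : Real.circleAverage (fun ζ : ℂ => v (a + ζ • b) + ε / 2) 0 1 =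
      Real.circleAverage (fun ζ : ℂ => v (a + ζ • b)) 0 1 + ε / 2 := by
    have := Real.circleAverage_add (hci v hv) (circleIntegrable_const (ε / 2) 0 1)
    rw [Real.circleAverage_const] at this
    exact this
  have h4 := hmean n a b
  linarith [h1.2]

/-! ### Pluriharmonicity of real parts of holomorphic functions -/

theorem isPluriharmonicOn_of_eventuallyEq_re {u : ℂ × ℂ × ℂ → ℝ} {Ω : Set (ℂ × ℂ × ℂ)}
    (h : ∀ a ∈ Ω, ∃ Φ : ℂ × ℂ × ℂ → ℂ, ContDiffAt ℂ 2 Φ a ∧ u =ᶠ[𝓝 a] fun q => (Φ q).re) :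
    IsPluriharmonicOn u Ω := by
  refine ⟨fun a ha => ?_, fun a ha b => ?_⟩
  · obtain ⟨Φ, hΦ, hu⟩ := h a ha
    have h1 : ContDiffAt ℝ 2 (fun q => (Φ q).re) a :=
      Complex.reCLM.contDiff.contDiffAt.comp a (hΦ.restrict_scalars ℝ)
    exact (h1.congr_of_eventuallyEq hu).contDiffWithinAt
  · obtain ⟨Φ, hΦ, hu⟩ := h a ha
    have hline : ContDiff ℂ 2 (fun ζ : ℂ => a + ζ • b) := by fun_prop
    have h0 : a + (0 : ℂ) • b = a := by simp
    have hcomp : ContDiffAt ℂ 2 (fun ζ : ℂ => Φ (a + ζ • b)) 0 :=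
      ContDiffAt.comp (0 : ℂ) (g := Φ) (by rwa [h0]) hline.contDiffAt
    -- Being `C²` over `ℂ` at a point includes complex differentiability nearby, hence analyticity.
    have han : AnalyticAt ℂ (fun ζ : ℂ => Φ (a + ζ • b)) 0 := by
      rw [Complex.analyticAt_iff_eventually_differentiableAt]
      exact (hcomp.eventually (by simp)).mono fun z hz => hz.differentiableAt (by simp)
    have ht : Tendsto (fun ζ : ℂ => a + ζ • b) (𝓝 0) (𝓝 a) := by
      simpa using hline.continuous.tendsto 0
    exact (InnerProductSpace.harmonicAt_congr_nhds (hu.comp_tendsto ht)).2 han.harmonicAt_re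

/-! ### Escape systems: the weighted estimates behind the dynamics -/

/-- An automorphism `F` of `ℂ³`, linear in the first coordinate, together with a pair `X`, `Y` of
coordinates of the remaining `ℂ²`. The `Y`-coordinate of `F` is asymptotic to `κ Y ^ d`, and the
`X`-coordinate of `F⁻¹` to `κ' X ^ d`, in the grading in which the first coordinate has weight `1`
and `X`, `Y` have weight `D + 1`. -/
structure EscapeSystem where
  F : Equiv.Perm (ℂ × ℂ × ℂ)
  X : ℂ × ℂ × ℂ →L[ℂ] ℂ
  Y : ℂ × ℂ × ℂ →L[ℂ] ℂ
  c : ℂ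
  κ : ℂ
  κ' : ℂ
  C : ℝ
  D : ℕ
  d : ℕ
  κ_ne_zero : κ ≠ 0
  κ'_ne_zero : κ' ≠ 0
  two_le_d : 2 ≤ d
  contDiff_F : ContDiff ℂ (⊤ : ℕ∞) F
  euclideanNorm_eq : ∀ q, SkewHenon.euclideanNorm q = √(‖q.1‖ ^ 2 + ‖X q‖ ^ 2 + ‖Y q‖ ^ 2)
  fst_F : ∀ q, (F q).1 = c * q.1
  norm_Y_F_sub_le : ∀ q (ν : ℝ), 1 ≤ ν → ‖q.1‖ ≤ ν → ‖X q‖ ≤ ν ^ (D + 1) → ‖Y q‖ ≤ ν ^ (D + 1) →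
    ‖Y (F q) - κ * Y q ^ d‖ ≤ C * ν ^ ((D + 1) * d - 1)
  norm_X_F_le : ∀ q (ν : ℝ), 1 ≤ ν → ‖q.1‖ ≤ ν → ‖X q‖ ≤ ν ^ (D + 1) → ‖Y q‖ ≤ ν ^ (D + 1) →
    ‖X (F q)‖ ≤ C * ν ^ ((D + 1) * d - 1)
  norm_X_inv_sub_le : ∀ q (ν : ℝ), 1 ≤ ν → ‖q.1‖ ≤ ν → ‖X q‖ ≤ ν ^ (D + 1) →
    ‖Y q‖ ≤ ν ^ (D + 1) → ‖X (F⁻¹ q) - κ' * X q ^ d‖ ≤ C * ν ^ ((D + 1) * d - 1)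

namespace EscapeSystem

open SkewHenon (euclideanNorm)

variable (S : EscapeSystem)

/-- The escape region. -/
def V (R : ℝ) : Set (ℂ × ℂ × ℂ) :=
  {q | if 1 ≤ ‖S.c‖ then max R (max ‖S.X q‖ (‖q.1‖ ^ (S.D + 1))) < ‖S.Y q‖
    else max R ‖S.X q‖ < ‖S.Y q‖ ∧ ‖q.1‖ < 1}

/-- The set of points whose orbit enters the escape region. -/
def U (R : ℝ) : Set (ℂ × ℂ × ℂ) := {q | ∃ n ≥ 1, (S.F ^ n) q ∈ S.V R}

variable {S}

theorem one_le_d : (1 : ℝ) ≤ S.d := by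
  have := S.two_le_d
  exact_mod_cast (by omega : 1 ≤ S.d)

theorem d_pos : (0 : ℝ) < S.d := zero_lt_one.trans_le one_le_d

theorem F_pow_succ (n : ℕ) (q : ℂ × ℂ × ℂ) : (S.F ^ (n + 1)) q = S.F ((S.F ^ n) q) := by
  rw [pow_succ', Equiv.Perm.mul_apply]

theorem F_pow_succ_apply (n : ℕ) (q : ℂ × ℂ × ℂ) : (S.F ^ (n + 1)) q = (S.F ^ n) (S.F q) := by
  rw [pow_succ, Equiv.Perm.mul_apply]

theorem F_pow_add (m n : ℕ) (q : ℂ × ℂ × ℂ) :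
    (S.F ^ (m + n)) q = (S.F ^ m) ((S.F ^ n) q) := by
  rw [pow_add, Equiv.Perm.mul_apply]

theorem contDiff_pow (n : ℕ) : ContDiff ℂ (⊤ : ℕ∞) (S.F ^ n) := by
  induction n with
  | zero => exact contDiff_id
  | succ n ih =>
    have : ⇑(S.F ^ (n + 1)) = S.F ∘ (S.F ^ n) := funext (F_pow_succ n)
    rw [this]
    exact S.contDiff_F.comp ih

theorem continuous_pow (n : ℕ) : Continuous (S.F ^ n) := (contDiff_pow n).continuous

theorem fst_pow (n : ℕ) (q : ℂ × ℂ × ℂ) : ((S.F ^ n) q).1 = S.c ^ n * q.1 := by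
  induction n with
  | zero => simp
  | succ n ih => rw [F_pow_succ, S.fst_F, ih, pow_succ']; ring

/-! ### Elementary inequalities -/

theorem norm_fst_le (q : ℂ × ℂ × ℂ) : ‖q.1‖ ≤ euclideanNorm q := by
  rw [euclideanNorm]
  exact Real.le_sqrt_of_sq_le (by nlinarith [sq_nonneg ‖q.2.1‖, sq_nonneg ‖q.2.2‖])

theorem norm_X_le (q : ℂ × ℂ × ℂ) : ‖S.X q‖ ≤ euclideanNorm q := by
  rw [S.euclideanNorm_eq]
  exact Real.le_sqrt_of_sq_le (by nlinarith [sq_nonneg ‖q.1‖, sq_nonneg ‖S.Y q‖])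

theorem norm_Y_le (q : ℂ × ℂ × ℂ) : ‖S.Y q‖ ≤ euclideanNorm q := by
  rw [S.euclideanNorm_eq]
  exact Real.le_sqrt_of_sq_le (by nlinarith [sq_nonneg ‖q.1‖, sq_nonneg ‖S.X q‖])

theorem euclideanNorm_le (q : ℂ × ℂ × ℂ) : euclideanNorm q ≤ ‖q.1‖ + ‖S.X q‖ + ‖S.Y q‖ := by
  rw [S.euclideanNorm_eq]
  refine Real.sqrt_le_iff.2 ⟨by positivity, ?_⟩
  nlinarith [mul_nonneg (norm_nonneg q.1) (norm_nonneg (S.X q)),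
    mul_nonneg (norm_nonneg q.1) (norm_nonneg (S.Y q)),
    mul_nonneg (norm_nonneg (S.X q)) (norm_nonneg (S.Y q))]

theorem _root_.SkewHenon.euclideanNorm_nonneg (q : ℂ × ℂ × ℂ) : 0 ≤ euclideanNorm q :=
  Real.sqrt_nonneg _

theorem le_of_pow_succ_le_pow_succ {a b : ℝ} {n : ℕ} (hb : 0 ≤ b)
    (h : a ^ (n + 1) ≤ b ^ (n + 1)) : a ≤ b := by
  by_contra! hlt
  exact absurd h (not_le.2 (pow_lt_pow_left₀ hlt hb n.succ_ne_zero))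

/-- A positive real number `t ≥ 1` is the `(n + 1)`-st power of some `ν ≥ 1`. -/
theorem exists_one_le_pow_eq (n : ℕ) {t : ℝ} (ht : 1 ≤ t) : ∃ ν : ℝ, 1 ≤ ν ∧ ν ^ (n + 1) = t := by
  refine ⟨t ^ (((n + 1 : ℕ) : ℝ)⁻¹), Real.one_le_rpow ht (by positivity), ?_⟩
  exact Real.rpow_inv_natCast_pow (by linarith) n.succ_ne_zero

theorem V_spec {R : ℝ} (hR : 1 ≤ R) {q : ℂ × ℂ × ℂ} (hq : q ∈ S.V R) :
    R < ‖S.Y q‖ ∧ ‖S.X q‖ < ‖S.Y q‖ ∧ ‖q.1‖ ^ (S.D + 1) < ‖S.Y q‖ := by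
  unfold V at hq
  rw [Set.mem_ofPred_eq] at hq
  split_ifs at hq with h
  · simp only [max_lt_iff] at hq
    exact hq
  · simp only [max_lt_iff] at hq
    refine ⟨hq.1.1, hq.1.2, lt_of_le_of_lt ?_ (hR.trans_lt hq.1.1)⟩
    exact pow_le_one₀ (norm_nonneg _) hq.2.le

theorem V_norm_fst {R : ℝ} {q : ℂ × ℂ × ℂ} (hq : q ∈ S.V R) : 1 ≤ ‖S.c‖ ∨ ‖q.1‖ < 1 := by
  unfold V at hq
  rw [Set.mem_ofPred_eq] at hq
  split_ifs at hq with h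
  · exact .inl h
  · exact .inr hq.2

theorem mem_V {R : ℝ} {q : ℂ × ℂ × ℂ} (h1 : R < ‖S.Y q‖) (h2 : ‖S.X q‖ < ‖S.Y q‖)
    (h3 : ‖q.1‖ ^ (S.D + 1) < ‖S.Y q‖) (h4 : 1 ≤ ‖S.c‖ ∨ ‖q.1‖ < 1) : q ∈ S.V R := by
  unfold V
  rw [Set.mem_ofPred_eq]
  split_ifs with h
  · simp only [max_lt_iff]; exact ⟨h1, h2, h3⟩
  · simp only [max_lt_iff]; exact ⟨⟨h1, h2⟩, h4.resolve_left h⟩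

theorem isOpen_V (R : ℝ) : IsOpen (S.V R) := by
  by_cases hc : 1 ≤ ‖S.c‖
  · simp only [V, hc, if_true]
    exact isOpen_lt (by fun_prop) (by fun_prop)
  · simp only [V, hc, if_false]
    exact (isOpen_lt (f := fun q => max R ‖S.X q‖) (g := fun q => ‖S.Y q‖)
      (by fun_prop) (by fun_prop)).inter
        (isOpen_lt (f := fun q : ℂ × ℂ × ℂ => ‖q.1‖) (by fun_prop) continuous_const)

theorem isOpen_U (R : ℝ) : IsOpen (S.U R) := by
  have : S.U R = ⋃ n : ℕ, ⋃ _ : n ≥ 1, ⇑(S.F ^ n) ⁻¹' S.V R := by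
    ext q; simp [U]
  rw [this]
  exact isOpen_biUnion fun n _ => (isOpen_V R).preimage (continuous_pow n)

/-! ### Invariance of the escape region -/

theorem pow_pred_mul (ν : ℝ) : ν ^ ((S.D + 1) * S.d - 1) * ν = (ν ^ (S.D + 1)) ^ S.d := by
  rw [← pow_succ, ← pow_mul]
  congr 1
  have : 1 ≤ (S.D + 1) * S.d := by
    have := S.two_le_d
    exact Nat.mul_pos (by omega) (by omega)
  omega

/-- If `t` is large, error terms of weight `(D + 1) d - 1` are small compared to `t ^ d`. -/
theorem exists_error_bound {ε : ℝ} (hε : 0 < ε) : ∃ R₁ : ℝ, 1 ≤ R₁ ∧ ∀ t : ℝ, R₁ ≤ t →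
    ∃ ν : ℝ, 1 ≤ ν ∧ ν ^ (S.D + 1) = t ∧ S.C * ν ^ ((S.D + 1) * S.d - 1) ≤ ε * t ^ S.d := by
  -- The error has one factor `ν` less than `t ^ d`, so `ν ≥ C / ε` suffices.
  set b : ℝ := max 1 (S.C / ε) with hb
  have hb1 : 1 ≤ b := le_max_left _ _
  refine ⟨b ^ (S.D + 1), one_le_pow₀ hb1, fun t ht => ?_⟩
  obtain ⟨ν, hν, hνt⟩ := exists_one_le_pow_eq S.D ((one_le_pow₀ hb1).trans ht)
  refine ⟨ν, hν, hνt, ?_⟩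
  have hbν : b ≤ ν := le_of_pow_succ_le_pow_succ (by linarith) (hνt ▸ ht)
  have hC : S.C ≤ ε * ν := by
    have : S.C / ε ≤ ν := (le_max_right _ _).trans hbν
    rwa [div_le_iff₀' hε] at this
  rw [← hνt, ← pow_pred_mul]
  calc S.C * ν ^ ((S.D + 1) * S.d - 1) ≤ (ε * ν) * ν ^ ((S.D + 1) * S.d - 1) := by gcongr
    _ = _ := by ring

/-- Take `ν` with `ν ^ (D + 1) = ‖Y q‖`. Both errors are then at most a quarter of `‖κ Y ^ d‖`, so
`Y` stays dominant over `X`; as `d ≥ 2`, it also outgrows the factor `‖c‖ ^ (D + 1)` gained by the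
parameter. The bound on the ratio keeps it in the domain of the principal logarithm. -/
theorem exists_V_invariant : ∃ R₁ : ℝ, 1 ≤ R₁ ∧ ∀ R ≥ R₁, ∀ q ∈ S.V R,
    S.F q ∈ S.V R ∧ ‖S.Y (S.F q) / (S.κ * S.Y q ^ S.d) - 1‖ ≤ 1 / 2 := by
  have hκ : 0 < ‖S.κ‖ := norm_pos_iff.2 S.κ_ne_zero
  obtain ⟨R₁, hR₁, h⟩ := S.exists_error_bound (ε := ‖S.κ‖ / 4) (by positivity)
  -- Since `t ^ d ≥ t ^ 2 ≥ R t`, this threshold makes `‖κ‖ t ^ d` at least `2 (1 + ‖c‖ ^ (D + 1))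
  -- t`.
  refine ⟨max R₁ (2 * (1 + ‖S.c‖ ^ (S.D + 1)) / ‖S.κ‖), hR₁.trans (le_max_left _ _), ?_⟩
  intro R hR q hq
  have hRR : R₁ ≤ R := (le_max_left _ _).trans hR
  obtain ⟨hY, hX, hl⟩ := V_spec (hR₁.trans hRR) hq
  set t := ‖S.Y q‖ with ht
  have ht1 : 1 ≤ t := by linarith
  obtain ⟨ν, hν, hνt, hC⟩ := h t (by linarith)
  have hlν : ‖q.1‖ ≤ ν := le_of_pow_succ_le_pow_succ (by linarith) (hνt ▸ hl.le)
  have e1 := (S.norm_Y_F_sub_le q ν hν hlν (hνt ▸ hX.le) hνt.ge).trans hC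
  have e2 := (S.norm_X_F_le q ν hν hlν (hνt ▸ hX.le) hνt.ge).trans hC
  have hn : ‖S.κ * S.Y q ^ S.d‖ = ‖S.κ‖ * t ^ S.d := by rw [norm_mul, norm_pow]
  have hpos : 0 < ‖S.κ‖ * t ^ S.d := by positivity
  have hlow : 3 / 4 * (‖S.κ‖ * t ^ S.d) ≤ ‖S.Y (S.F q)‖ := by
    have := norm_sub_norm_le (S.κ * S.Y q ^ S.d) (S.Y (S.F q))
    rw [norm_sub_rev, hn] at this
    linarith
  have hlarge : (1 + ‖S.c‖ ^ (S.D + 1)) * t < 3 / 4 * (‖S.κ‖ * t ^ S.d) := by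
    have h2 : 2 * (1 + ‖S.c‖ ^ (S.D + 1)) ≤ R * ‖S.κ‖ := by
      have := (le_max_right _ _).trans hR
      rwa [div_le_iff₀ hκ] at this
    have h3 : t ^ 2 ≤ t ^ S.d := pow_le_pow_right₀ ht1 S.two_le_d
    have h4 : ‖S.κ‖ * t ^ 2 ≤ ‖S.κ‖ * t ^ S.d := by gcongr
    have h5 : (R * ‖S.κ‖) * t ≤ (t * ‖S.κ‖) * t := by gcongr
    have h6 : 2 * (1 + ‖S.c‖ ^ (S.D + 1)) * t ≤ (R * ‖S.κ‖) * t := by gcongr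
    nlinarith
  have hcpos : 0 ≤ ‖S.c‖ ^ (S.D + 1) := by positivity
  refine ⟨mem_V ?_ ?_ ?_ ?_, ?_⟩
  · nlinarith
  · linarith
  · rw [S.fst_F, norm_mul, mul_pow]
    have : ‖S.c‖ ^ (S.D + 1) * ‖q.1‖ ^ (S.D + 1) ≤ ‖S.c‖ ^ (S.D + 1) * t := by gcongr
    nlinarith
  · rcases V_norm_fst hq with h | h
    · exact .inl h
    · by_cases hc : 1 ≤ ‖S.c‖
      · exact .inl hc
      · right
        rw [S.fst_F, norm_mul]
        push Not at hc
        nlinarith [norm_nonneg S.c, norm_nonneg q.1]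
  · have hne : S.κ * S.Y q ^ S.d ≠ 0 := by rw [← norm_pos_iff, hn]; exact hpos
    rw [div_sub_one hne, norm_div, hn, div_le_iff₀ hpos]
    linarith

/-- Where `X` dominates, `X ∘ F⁻¹` is `κ' X ^ d` up to half its size. Read forwards, a point that
lands where `X` is large and dominant came from one with `X` at least as large. -/
theorem exists_norm_X_le_norm_X_inv : ∃ R₁ : ℝ, 1 ≤ R₁ ∧ ∀ q : ℂ × ℂ × ℂ, R₁ ≤ ‖S.X q‖ →
    ‖S.Y q‖ ≤ ‖S.X q‖ → ‖q.1‖ ^ (S.D + 1) ≤ ‖S.X q‖ → ‖S.X q‖ ≤ ‖S.X (S.F⁻¹ q)‖ := by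
  have hκ : 0 < ‖S.κ'‖ := norm_pos_iff.2 S.κ'_ne_zero
  obtain ⟨R₁, hR₁, h⟩ := S.exists_error_bound (ε := ‖S.κ'‖ / 2) (by positivity)
  refine ⟨max R₁ (2 / ‖S.κ'‖), hR₁.trans (le_max_left _ _), ?_⟩
  intro q hR hY hl
  have hRR : R₁ ≤ ‖S.X q‖ := (le_max_left _ _).trans hR
  set t := ‖S.X q‖ with ht
  have ht1 : 1 ≤ t := by linarith
  obtain ⟨ν, hν, hνt, hC⟩ := h t hRR
  have hlν : ‖q.1‖ ≤ ν := le_of_pow_succ_le_pow_succ (by linarith) (hνt ▸ hl)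
  have e1 := (S.norm_X_inv_sub_le q ν hν hlν hνt.ge (hνt ▸ hY)).trans hC
  have hn : ‖S.κ' * S.X q ^ S.d‖ = ‖S.κ'‖ * t ^ S.d := by rw [norm_mul, norm_pow]
  have h1 := norm_sub_norm_le (S.κ' * S.X q ^ S.d) (S.X (S.F⁻¹ q))
  rw [norm_sub_rev, hn] at h1
  have h2 : 2 ≤ t * ‖S.κ'‖ := by
    have := (le_max_right _ _).trans hR
    rwa [div_le_iff₀ hκ] at this
  have h3 : t ^ 2 ≤ t ^ S.d := pow_le_pow_right₀ ht1 S.two_le_d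
  have h4 : ‖S.κ'‖ * t ^ 2 ≤ ‖S.κ'‖ * t ^ S.d := by gcongr
  have h5 : 2 * t ≤ (t * ‖S.κ'‖) * t := by gcongr
  nlinarith

/-! ### Growth of orbits that have not yet escaped -/

/-- If `F p` is not in `V`, then `Y` does not dominate there: either both coordinates are below the
threshold, or `X` dominates and has not grown. The condition on `c` excludes points that miss `V`
only through the clause `‖q.1‖ < 1`. -/
theorem max_norm_F_le_of_notMem_V : ∃ R₁ : ℝ, 1 ≤ R₁ ∧ ∀ R ≥ R₁, ∀ p : ℂ × ℂ × ℂ,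
    S.F p ∉ S.V R → (1 ≤ ‖S.c‖ ∨ ‖(S.F p).1‖ < 1) →
    max ‖S.X (S.F p)‖ ‖S.Y (S.F p)‖ ≤
      max (max ‖S.X p‖ ‖S.Y p‖) (max R (‖(S.F p).1‖ ^ (S.D + 1))) := by
  obtain ⟨R₁, hR₁, h⟩ := S.exists_norm_X_le_norm_X_inv
  refine ⟨R₁, hR₁, fun R hR p hp hc => ?_⟩
  have hY : ‖S.Y (S.F p)‖ ≤ max ‖S.X (S.F p)‖ (max R (‖(S.F p).1‖ ^ (S.D + 1))) := by
    by_contra! hlt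
    simp only [max_lt_iff] at hlt
    exact hp (mem_V hlt.2.1 hlt.1 hlt.2.2 hc)
  rcases le_total ‖S.X (S.F p)‖ (max R (‖(S.F p).1‖ ^ (S.D + 1))) with hX | hX
  · rw [max_eq_right hX] at hY
    exact (max_le hX hY).trans (le_max_right _ _)
  · rw [max_eq_left hX] at hY
    rw [max_eq_left hY]
    have := h (S.F p) (hR.trans ((le_max_left _ _).trans hX)) hY ((le_max_right _ _).trans hX)
    rw [show S.F⁻¹ (S.F p) = p from S.F.symm_apply_apply p] at this
    exact this.trans ((le_max_left _ _).trans (le_max_left _ _))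

/-- Before escape only the parameter drives growth, so the orbit grows at most geometrically with
ratio `max 1 (‖c‖ ^ (D + 1))`. -/
theorem exists_posLog_le_of_notMem_V : ∃ R₁ : ℝ, 1 ≤ R₁ ∧ ∀ R ≥ R₁, ∀ Q : Set (ℂ × ℂ × ℂ),
    IsCompact Q → ∃ B : ℝ, 0 ≤ B ∧ ∀ q ∈ Q, ∀ n : ℕ, (∀ k, 1 ≤ k → k ≤ n → (S.F ^ k) q ∉ S.V R) →
    Real.posLog (euclideanNorm ((S.F ^ n) q)) ≤ B * (n + 1) := by
  obtain ⟨R₁, hR₁, hstep⟩ := S.max_norm_F_le_of_notMem_V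
  refine ⟨R₁, hR₁, fun R hR Q hQ => ?_⟩
  -- For `‖c‖ < 1` the clause `‖q.1‖ < 1` of `V` holds from a time `n₀` on that is uniform over `Q`;
  -- the first `n₀` iterates are bounded by compactness.
  obtain ⟨n₀, hn₀⟩ : ∃ n₀ : ℕ, ∀ q ∈ Q, ∀ k ≥ n₀, 1 ≤ ‖S.c‖ ∨ ‖((S.F ^ k) q).1‖ < 1 := by
    by_cases hc : 1 ≤ ‖S.c‖
    · exact ⟨0, fun _ _ _ _ => .inl hc⟩
    · push Not at hc
      obtain ⟨M, hM⟩ := hQ.exists_bound_of_continuousOn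
        (f := fun q : ℂ × ℂ × ℂ => q.1) continuous_fst.continuousOn
      have hM1 : 0 < |M| + 1 := by positivity
      obtain ⟨n₀, hn₀⟩ := exists_pow_lt_of_lt_one (inv_pos.2 hM1) hc
      refine ⟨n₀, fun q hq k hk => .inr ?_⟩
      rw [fst_pow, norm_mul, norm_pow]
      calc ‖S.c‖ ^ k * ‖q.1‖ ≤ ‖S.c‖ ^ n₀ * (|M| + 1) := by
            have h1 : ‖S.c‖ ^ k ≤ ‖S.c‖ ^ n₀ := pow_le_pow_of_le_one (norm_nonneg _) hc.le hk
            have h2 : ‖q.1‖ ≤ |M| + 1 := by linarith [hM q hq, le_abs_self M]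
            gcongr
        _ < (|M| + 1)⁻¹ * (|M| + 1) := by gcongr
        _ = 1 := inv_mul_cancel₀ hM1.ne'
  -- All summands are nonnegative, so one bound for the sum bounds the parameter, the initial
  -- iterates and `R`.
  obtain ⟨M, hM⟩ := hQ.exists_bound_of_continuousOn (f := fun q : ℂ × ℂ × ℂ =>
    (‖q.1‖ ^ (S.D + 1) + ∑ k ∈ Finset.range (n₀ + 1), euclideanNorm ((S.F ^ k) q) + R))
    (by
      have h1 : Continuous fun q : ℂ × ℂ × ℂ =>
          ∑ k ∈ Finset.range (n₀ + 1), euclideanNorm ((S.F ^ k) q) :=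
        continuous_finsetSum _ fun k _ => continuous_euclideanNorm.comp (continuous_pow k)
      fun_prop)
  have hR1 : 1 ≤ R := hR₁.trans hR
  have hterm : ∀ q ∈ Q, ‖q.1‖ ^ (S.D + 1) ≤ M ∧ R ≤ M ∧
      ∀ k ≤ n₀, euclideanNorm ((S.F ^ k) q) ≤ M := by
    intro q hq
    have h0 := (le_abs_self _).trans (hM q hq)
    have h1 : 0 ≤ ∑ k ∈ Finset.range (n₀ + 1), euclideanNorm ((S.F ^ k) q) :=
      Finset.sum_nonneg fun k _ => SkewHenon.euclideanNorm_nonneg _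
    have h2 : 0 ≤ ‖q.1‖ ^ (S.D + 1) := by positivity
    refine ⟨by linarith, by linarith, fun k hk => ?_⟩
    have h3 : euclideanNorm ((S.F ^ k) q) ≤
        ∑ k ∈ Finset.range (n₀ + 1), euclideanNorm ((S.F ^ k) q) :=
      Finset.single_le_sum (f := fun k => euclideanNorm ((S.F ^ k) q))
        (fun k _ => SkewHenon.euclideanNorm_nonneg _) (Finset.mem_range.2 (by omega))
    linarith
  set Γ : ℝ := max 1 (‖S.c‖ ^ (S.D + 1)) with hΓ
  have hΓ1 : 1 ≤ Γ := le_max_left _ _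
  refine ⟨Real.posLog (3 * M) + Real.posLog Γ,
    add_nonneg Real.posLog_nonneg Real.posLog_nonneg, fun q hq n hn => ?_⟩
  obtain ⟨hM1, hM2, hM3⟩ := hterm q hq
  have hM0 : 1 ≤ M := by linarith
  have hΓn : ∀ n : ℕ, 1 ≤ Γ ^ n := fun n => one_le_pow₀ hΓ1
  have hfst : ∀ n : ℕ, ‖((S.F ^ n) q).1‖ ^ (S.D + 1) ≤ M * Γ ^ n := by
    intro n
    rw [fst_pow, norm_mul, norm_pow, mul_pow, ← pow_mul, mul_comm n, pow_mul, mul_comm]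
    gcongr
    exact le_max_right _ _
  have hbound : euclideanNorm ((S.F ^ n) q) ≤ 3 * M * Γ ^ n := by
    rcases le_total n n₀ with hle | hle
    · nlinarith [hM3 n hle, hΓn n]
    · have hind : ∀ m ≥ n₀, m ≤ n →
          max ‖S.X ((S.F ^ m) q)‖ ‖S.Y ((S.F ^ m) q)‖ ≤ M * Γ ^ m := by
        intro m hm
        induction m, hm using Nat.le_induction with
        | base =>
          intro _
          have h1 := hM3 n₀ le_rfl
          have h2 : M ≤ M * Γ ^ n₀ := le_mul_of_one_le_right (by linarith) (hΓn n₀)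
          exact max_le (((norm_X_le _).trans h1).trans h2) (((norm_Y_le _).trans h1).trans h2)
        | succ m hm ih =>
          intro hmn
          have h2 : M * Γ ^ m ≤ M * Γ ^ (m + 1) := by
            have := pow_le_pow_right₀ hΓ1 (Nat.le_succ m)
            gcongr
          have h3 : M ≤ M * Γ ^ (m + 1) := le_mul_of_one_le_right (by linarith) (hΓn _)
          have h4 := hfst (m + 1)
          have h5 := hn (m + 1) (by omega) hmn
          have h6 := hn₀ q hq (m + 1) (by omega)
          rw [F_pow_succ] at h4 h5 h6 ⊢
          exact (hstep R hR _ h5 h6).trans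
            (max_le ((ih (by omega)).trans h2) (max_le (hM2.trans h3) h4))
      have h1 := hind n hle le_rfl
      have h2 : ‖((S.F ^ n) q).1‖ ≤ M * Γ ^ n := by
        rcases le_total ‖((S.F ^ n) q).1‖ 1 with h | h
        · nlinarith [hΓn n]
        · exact (le_self_pow₀ h S.D.succ_ne_zero).trans (hfst n)
      have h3 := S.euclideanNorm_le ((S.F ^ n) q)
      linarith [(le_max_left _ _).trans h1, (le_max_right _ _).trans h1]
  calc Real.posLog (euclideanNorm ((S.F ^ n) q)) ≤ Real.posLog (3 * M * Γ ^ n) :=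
        Real.posLog_le_posLog (SkewHenon.euclideanNorm_nonneg _) hbound
    _ ≤ Real.posLog (3 * M) + Real.posLog (Γ ^ n) := Real.posLog_mul
    _ = Real.posLog (3 * M) + n * Real.posLog Γ := by rw [Real.posLog_pow]
    _ ≤ _ := by
        have h1 : 0 ≤ Real.posLog (3 * M) := Real.posLog_nonneg
        have h2 : 0 ≤ Real.posLog Γ := Real.posLog_nonneg
        have h3 : (0 : ℝ) ≤ n := n.cast_nonneg
        nlinarith [mul_nonneg h1 h3]

end EscapeSystem

/-! ### Admissible radii and the Green function of an escape system -/

namespace EscapeSystem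

open SkewHenon (euclideanNorm)

variable {S : EscapeSystem}

/-- The properties of a radius `R` that the construction of the Green function depends on. -/
structure IsEscapeRadius (S : EscapeSystem) (R : ℝ) : Prop where
  one_le : 1 ≤ R
  F_mem : ∀ q ∈ S.V R, S.F q ∈ S.V R
  norm_ratio_sub_one_le : ∀ q ∈ S.V R, ‖S.Y (S.F q) / (S.κ * S.Y q ^ S.d) - 1‖ ≤ 1 / 2
  posLog_le : ∀ Q : Set (ℂ × ℂ × ℂ), IsCompact Q → ∃ B : ℝ, 0 ≤ B ∧ ∀ q ∈ Q, ∀ n : ℕ,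
    (∀ k, 1 ≤ k → k ≤ n → (S.F ^ k) q ∉ S.V R) →
    Real.posLog (euclideanNorm ((S.F ^ n) q)) ≤ B * (n + 1)
  lt_log : |Real.log ‖S.κ‖| + 1 < Real.log R

theorem exists_isEscapeRadius (S : EscapeSystem) : ∃ R₀ : ℝ, ∀ R ≥ R₀, S.IsEscapeRadius R := by
  obtain ⟨R₁, h₁, hV⟩ := S.exists_V_invariant
  obtain ⟨R₂, _, hQ⟩ := S.exists_posLog_le_of_notMem_V
  refine ⟨max R₁ (max R₂ (Real.exp (|Real.log ‖S.κ‖| + 2))), fun R hR => ?_⟩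
  obtain ⟨hR₁, hR₂, hR₃⟩ : R₁ ≤ R ∧ R₂ ≤ R ∧ Real.exp (|Real.log ‖S.κ‖| + 2) ≤ R := by
    simpa only [ge_iff_le, max_le_iff] using hR
  refine ⟨h₁.trans hR₁, fun q hq => (hV R hR₁ q hq).1, fun q hq => (hV R hR₁ q hq).2,
    hQ R hR₂, ?_⟩
  rw [Real.lt_log_iff_exp_lt (by linarith)]
  exact (Real.exp_lt_exp.2 (by linarith)).trans_le hR₃

/-! ### The holomorphic error term in the escape region -/

/-- The principal branch of `log (Y ∘ F / (κ Y ^ d))`. -/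
def logRatio (S : EscapeSystem) (q : ℂ × ℂ × ℂ) : ℂ :=
  Complex.log (S.Y (S.F q) / (S.κ * S.Y q ^ S.d))

/-- As `d ≥ 2`, the geometric series of the corrections is at most its numerator, the constant with
which `lt_log` compares `log R`. -/
theorem hasSum_bound (S : EscapeSystem) :
    Summable (fun k : ℕ => (|Real.log ‖S.κ‖| + 1) / (S.d : ℝ) ^ (k + 1)) ∧
    ∑' k : ℕ, (|Real.log ‖S.κ‖| + 1) / (S.d : ℝ) ^ (k + 1) ≤ |Real.log ‖S.κ‖| + 1 := by
  have h2 : (2 : ℝ) ≤ S.d := by exact_mod_cast S.two_le_d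
  have hgeo := hasSum_geometric_two' (|Real.log ‖S.κ‖| + 1)
  have hle : ∀ k : ℕ, (|Real.log ‖S.κ‖| + 1) / (S.d : ℝ) ^ (k + 1) ≤
      (|Real.log ‖S.κ‖| + 1) / 2 / 2 ^ k := by
    intro k
    rw [div_div, ← pow_succ']
    gcongr
  have hs : Summable (fun k : ℕ => (|Real.log ‖S.κ‖| + 1) / (S.d : ℝ) ^ (k + 1)) :=
    Summable.of_nonneg_of_le (fun k => by positivity) hle hgeo.summable
  exact ⟨hs, (hs.tsum_le_tsum hle hgeo.summable).trans_eq hgeo.tsum_eq⟩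

namespace IsEscapeRadius

variable {R : ℝ} (hR : S.IsEscapeRadius R)
include hR

theorem one_lt_norm_Y {q : ℂ × ℂ × ℂ} (hq : q ∈ S.V R) : 1 < ‖S.Y q‖ :=
  hR.one_le.trans_lt (V_spec hR.one_le hq).1

theorem Y_ne_zero {q : ℂ × ℂ × ℂ} (hq : q ∈ S.V R) : S.Y q ≠ 0 :=
  norm_pos_iff.1 (zero_lt_one.trans (hR.one_lt_norm_Y hq))

theorem pow_mem {q : ℂ × ℂ × ℂ} (hq : q ∈ S.V R) (n : ℕ) : (S.F ^ n) q ∈ S.V R := by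
  induction n with
  | zero => simpa
  | succ n ih => rw [F_pow_succ]; exact hR.F_mem _ ih

theorem norm_logRatio_le {q : ℂ × ℂ × ℂ} (hq : q ∈ S.V R) : ‖S.logRatio q‖ ≤ 1 := by
  have h := hR.norm_ratio_sub_one_le q hq
  have := Complex.norm_log_one_add_half_le_self h
  rw [add_sub_cancel] at this
  unfold logRatio
  linarith

theorem contDiffAt_logRatio {q : ℂ × ℂ × ℂ} (hq : q ∈ S.V R) :
    ContDiffAt ℂ (⊤ : ℕ∞) S.logRatio q := by
  have hne : S.κ * S.Y q ^ S.d ≠ 0 := mul_ne_zero S.κ_ne_zero (pow_ne_zero _ (hR.Y_ne_zero hq))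
  have h := hR.norm_ratio_sub_one_le q hq
  have hslit : S.Y (S.F q) / (S.κ * S.Y q ^ S.d) ∈ Complex.slitPlane := by
    have := Complex.mem_slitPlane_of_norm_lt_one (h.trans_lt (by norm_num))
    rwa [add_sub_cancel] at this
  have h1 : ContDiffAt ℂ (⊤ : ℕ∞) (fun q => S.Y (S.F q)) q :=
    (S.Y.contDiff.comp S.contDiff_F).contDiffAt
  have h2 : ContDiffAt ℂ (⊤ : ℕ∞) (fun q => S.κ * S.Y q ^ S.d) q :=
    (contDiff_const.mul (S.Y.contDiff.pow _)).contDiffAt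
  exact (Complex.contDiffAt_log hslit).comp q (h1.div h2 hne)

theorem log_norm_Y_F {q : ℂ × ℂ × ℂ} (hq : q ∈ S.V R) :
    Real.log ‖S.Y (S.F q)‖ = S.d * Real.log ‖S.Y q‖ +
      ((Real.log ‖S.κ‖ : ℂ) + S.logRatio q).re := by
  have h0 := hR.Y_ne_zero hq
  have h1 := hR.Y_ne_zero (hR.F_mem q hq)
  have h2 := S.κ_ne_zero
  rw [logRatio, Complex.add_re, Complex.ofReal_re, Complex.log_re, norm_div, norm_mul, norm_pow,
    Real.log_div (by positivity) (by positivity), Real.log_mul (by positivity) (by positivity),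
    Real.log_pow]
  ring

theorem norm_log_add_logRatio_le {q : ℂ × ℂ × ℂ} (hq : q ∈ S.V R) :
    ‖(Real.log ‖S.κ‖ : ℂ) + S.logRatio q‖ ≤ |Real.log ‖S.κ‖| + 1 := by
  refine (norm_add_le _ _).trans (add_le_add ?_ (hR.norm_logRatio_le hq))
  rw [Complex.norm_real, Real.norm_eq_abs]

/-- In `V` all three coordinates are bounded by `‖Y q‖`, so the norm lies between `‖Y q‖` and `3 ‖Y
q‖`. -/
theorem log_norm_Y_le {q : ℂ × ℂ × ℂ} (hq : q ∈ S.V R) :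
    Real.log ‖S.Y q‖ ≤ Real.posLog (euclideanNorm q) ∧
      Real.posLog (euclideanNorm q) ≤ Real.log ‖S.Y q‖ + Real.log 3 := by
  have h1 := hR.one_lt_norm_Y hq
  obtain ⟨_, hX, hl⟩ := V_spec hR.one_le hq
  have hl' : ‖q.1‖ ≤ ‖S.Y q‖ := by
    rcases le_total ‖q.1‖ 1 with h | h
    · linarith
    · exact (le_self_pow₀ h S.D.succ_ne_zero).trans hl.le
  have h2 := S.norm_Y_le q
  have h3 : euclideanNorm q ≤ ‖S.Y q‖ * 3 := by linarith [S.euclideanNorm_le q]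
  rw [Real.posLog_eq_log (by rw [abs_of_nonneg (SkewHenon.euclideanNorm_nonneg q)]; linarith),
    ← Real.log_mul (by positivity) (by norm_num)]
  exact ⟨Real.log_le_log (by linarith) h2, Real.log_le_log (by linarith) h3⟩

end IsEscapeRadius

/-! ### Comparison of `log⁺ ‖F q‖` with `d log⁺ ‖q‖` -/

/-- A crude bound valid everywhere, from the polynomial growth of `F` alone; the lower bound is just
`log⁺ ≥ 0`. The error proportional to `log⁺ ‖q‖` is harmless before escape, where that quantity is
linear in time. -/
theorem exists_abs_posLog_F_sub_le (S : EscapeSystem) : ∃ A : ℝ, 0 ≤ A ∧ ∀ q,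
    |Real.posLog (euclideanNorm (S.F q)) - S.d * Real.posLog (euclideanNorm q)| ≤
      A * (1 + Real.posLog (euclideanNorm q)) := by
  set K : ℝ := ‖S.c‖ + ‖S.κ‖ + 2 * |S.C| with hK
  set m : ℕ := (S.D + 1) * S.d with hm
  have hK0 : 0 ≤ K := by positivity
  refine ⟨Real.posLog K + m + S.d, by have := Real.posLog_nonneg (x := K); positivity,
    fun q => ?_⟩
  set ν : ℝ := max 1 (euclideanNorm q) with hν
  have hν1 : 1 ≤ ν := le_max_left _ _
  have hνq : euclideanNorm q ≤ ν := le_max_right _ _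
  have hνlog : Real.posLog ν = Real.posLog (euclideanNorm q) := by
    rw [Real.posLog_eq_log_max_one (SkewHenon.euclideanNorm_nonneg q),
      Real.posLog_eq_log (by rw [abs_of_nonneg (by linarith)]; exact hν1)]
  have hself : ν ≤ ν ^ (S.D + 1) := le_self_pow₀ hν1 S.D.succ_ne_zero
  have hl : ‖q.1‖ ≤ ν := (norm_fst_le q).trans hνq
  have hX : ‖S.X q‖ ≤ ν ^ (S.D + 1) := ((norm_X_le q).trans hνq).trans hself
  have hY : ‖S.Y q‖ ≤ ν ^ (S.D + 1) := ((norm_Y_le q).trans hνq).trans hself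
  have hm1 : 1 ≤ m := by
    have := S.two_le_d
    exact Nat.mul_pos (by omega) (by omega)
  have hC : S.C * ν ^ (m - 1) ≤ |S.C| * ν ^ m := by
    have h1 : ν ^ (m - 1) ≤ ν ^ m := pow_le_pow_right₀ hν1 (Nat.sub_le _ _)
    have h2 := le_abs_self S.C
    gcongr
  have e1 := (S.norm_Y_F_sub_le q ν hν1 hl hX hY).trans hC
  have e2 := (S.norm_X_F_le q ν hν1 hl hX hY).trans hC
  have e3 : ‖S.κ * S.Y q ^ S.d‖ ≤ ‖S.κ‖ * ν ^ m := by
    rw [norm_mul, norm_pow, hm, pow_mul]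
    gcongr
  have e4 : ‖(S.F q).1‖ ≤ ‖S.c‖ * ν ^ m := by
    rw [S.fst_F, norm_mul]
    have : ν ≤ ν ^ m := le_self_pow₀ hν1 (by omega)
    gcongr
    exact hl.trans this
  have e5 : ‖S.Y (S.F q)‖ ≤ ‖S.κ‖ * ν ^ m + |S.C| * ν ^ m := by
    have := norm_sub_norm_le (S.Y (S.F q)) (S.κ * S.Y q ^ S.d)
    linarith
  have e6 : euclideanNorm (S.F q) ≤ K * ν ^ m := by
    have := S.euclideanNorm_le (S.F q)
    rw [hK]
    nlinarith
  have e7 : Real.posLog (euclideanNorm (S.F q)) ≤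
      Real.posLog K + m * Real.posLog (euclideanNorm q) := by
    calc _ ≤ Real.posLog (K * ν ^ m) :=
          Real.posLog_le_posLog (SkewHenon.euclideanNorm_nonneg _) e6
      _ ≤ Real.posLog K + Real.posLog (ν ^ m) := Real.posLog_mul
      _ = _ := by rw [Real.posLog_pow, hνlog]
  have p1 := Real.posLog_nonneg (x := K)
  have p2 := Real.posLog_nonneg (x := euclideanNorm q)
  have p3 := Real.posLog_nonneg (x := euclideanNorm (S.F q))
  have p4 := mul_nonneg p1 p2
  have p5 : (0 : ℝ) ≤ m := m.cast_nonneg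
  have p6 : (0 : ℝ) ≤ S.d := S.d.cast_nonneg
  have p7 := mul_nonneg p5 p2
  have p8 := mul_nonneg p6 p2
  rw [abs_le]
  constructor <;> nlinarith

theorem IsEscapeRadius.abs_posLog_F_sub_le {R : ℝ} (hR : S.IsEscapeRadius R) {q : ℂ × ℂ × ℂ}
    (hq : q ∈ S.V R) :
    |Real.posLog (euclideanNorm (S.F q)) - S.d * Real.posLog (euclideanNorm q)| ≤
      |Real.log ‖S.κ‖| + 1 + S.d * Real.log 3 := by
  obtain ⟨a1, a2⟩ := hR.log_norm_Y_le hq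
  obtain ⟨b1, b2⟩ := hR.log_norm_Y_le (hR.F_mem q hq)
  have h1 := hR.log_norm_Y_F hq
  have h2 := abs_le.1 ((Complex.abs_re_le_norm _).trans (hR.norm_log_add_logRatio_le hq))
  have hlog : 0 ≤ Real.log 3 := Real.log_nonneg (by norm_num)
  have hd := S.one_le_d
  have h3 : Real.log 3 ≤ S.d * Real.log 3 := le_mul_of_one_le_left hlog hd
  have h4 := mul_le_mul_of_nonneg_left a1 S.d_pos.le
  have h5 := mul_le_mul_of_nonneg_left a2 S.d_pos.le
  rw [abs_le]
  constructor <;> nlinarith [h2.1, h2.2]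

/-! ### The Green function -/

/-- The normalized growth `d⁻ⁿ log⁺ ‖Fⁿ‖`. -/
def growth (S : EscapeSystem) (n : ℕ) (q : ℂ × ℂ × ℂ) : ℝ :=
  Real.posLog (euclideanNorm ((S.F ^ n) q)) / (S.d : ℝ) ^ n

/-- The limit of `d⁻ⁿ log⁺ ‖Fⁿ‖`. -/
def green (S : EscapeSystem) (q : ℂ × ℂ × ℂ) : ℝ :=
  S.growth 0 q + ∑' n, (S.growth (n + 1) q - S.growth n q)

theorem continuous_growth (n : ℕ) : Continuous (S.growth n) := by
  unfold growth
  exact (Real.continuous_posLog.comp (continuous_euclideanNorm.comp (continuous_pow n))).div_const _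

theorem growth_succ_sub (n : ℕ) (q : ℂ × ℂ × ℂ) : S.growth (n + 1) q - S.growth n q =
    (Real.posLog (euclideanNorm (S.F ((S.F ^ n) q))) -
      S.d * Real.posLog (euclideanNorm ((S.F ^ n) q))) / (S.d : ℝ) ^ (n + 1) := by
  have := S.d_pos.ne'
  rw [growth, growth, F_pow_succ, pow_succ]
  field_simp

theorem summable_succ_div_pow {d : ℝ} (hd : 1 < d) (A : ℝ) :
    Summable fun n : ℕ => A * (n + 1) / d ^ (n + 1) := by
  have hr : ‖d⁻¹‖ < 1 := by
    rw [norm_inv, Real.norm_eq_abs, abs_of_pos (by linarith)]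
    exact inv_lt_one_of_one_lt₀ hd
  have h := (summable_pow_mul_geometric_of_norm_lt_one 1 hr)
  have h' := ((summable_nat_add_iff 1).2 h).mul_left A
  refine h'.congr fun n => ?_
  rw [pow_one, inv_pow]
  push_cast
  ring

theorem one_lt_d : (1 : ℝ) < S.d := by
  have := S.two_le_d
  exact_mod_cast (by omega : 1 < S.d)

/-- Weierstrass M-test for the telescoping series. If the orbit has entered `V` by time `n`, it is
still there and the increment has a bounded numerator; otherwise the crude bound and linear growth
apply. -/
theorem IsEscapeRadius.tendstoUniformlyOn_growth {R : ℝ} (hR : S.IsEscapeRadius R)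
    {Q : Set (ℂ × ℂ × ℂ)} (hQ : IsCompact Q) :
    TendstoUniformlyOn S.growth S.green atTop Q := by
  obtain ⟨B, hB, hQB⟩ := hR.posLog_le Q hQ
  obtain ⟨A, hA, hAF⟩ := S.exists_abs_posLog_F_sub_le
  set A' : ℝ := |Real.log ‖S.κ‖| + 1 + S.d * Real.log 3 with hA'
  have hA'0 : 0 ≤ A' := by
    have : 0 ≤ Real.log 3 := Real.log_nonneg (by norm_num)
    have := S.d_pos
    positivity
  have hbound : ∀ n : ℕ, ∀ q ∈ Q, ‖S.growth (n + 1) q - S.growth n q‖ ≤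
      (A' + A + A * B) * (n + 1) / (S.d : ℝ) ^ (n + 1) := by
    intro n q hq
    have hd : 0 < (S.d : ℝ) ^ (n + 1) := pow_pos S.d_pos _
    rw [growth_succ_sub, norm_div, Real.norm_eq_abs, Real.norm_of_nonneg hd.le]
    refine div_le_div_of_nonneg_right ?_ hd.le
    have hn : (0 : ℝ) ≤ n := n.cast_nonneg
    have hAB := mul_nonneg hA hB
    by_cases h : ∃ k, 1 ≤ k ∧ k ≤ n ∧ (S.F ^ k) q ∈ S.V R
    · obtain ⟨k, _, hkn, hk⟩ := h
      have hmem : (S.F ^ n) q ∈ S.V R := by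
        have := hR.pow_mem hk (n - k)
        rwa [← F_pow_add, Nat.sub_add_cancel hkn] at this
      refine (hR.abs_posLog_F_sub_le hmem).trans ?_
      rw [← hA']
      nlinarith [mul_nonneg hA'0 hn, mul_nonneg hA hn, mul_nonneg hAB hn]
    · push Not at h
      have h1 := hQB q hq n h
      refine (hAF _).trans ?_
      have h2 := mul_le_mul_of_nonneg_left h1 hA
      nlinarith [mul_nonneg hA'0 hn, mul_nonneg hA hn, mul_nonneg hAB hn]
  have hsum := summable_succ_div_pow S.one_lt_d (A' + A + A * B)
  have key := tendstoUniformlyOn_tsum_nat hsum hbound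
  rw [Metric.tendstoUniformlyOn_iff] at key ⊢
  intro ε hε
  filter_upwards [key ε hε] with n hn q hq
  have := hn q hq
  rw [Finset.sum_range_sub (fun n => S.growth n q)] at this
  rw [Real.dist_eq] at this ⊢
  rw [green]
  convert this using 2
  ring

namespace IsEscapeRadius

variable {R : ℝ} (hR : S.IsEscapeRadius R)
include hR

theorem tendsto_growth (q : ℂ × ℂ × ℂ) : Tendsto (fun n => S.growth n q) atTop (𝓝 (S.green q)) :=
  (hR.tendstoUniformlyOn_growth isCompact_singleton).tendsto_at (Set.mem_singleton q)

theorem green_F (q : ℂ × ℂ × ℂ) : S.green (S.F q) = S.d * S.green q := by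
  refine tendsto_nhds_unique (hR.tendsto_growth (S.F q)) ?_
  have h := ((tendsto_add_atTop_iff_nat 1).2 (hR.tendsto_growth q)).const_mul (S.d : ℝ)
  refine h.congr fun n => ?_
  have := S.d_pos.ne'
  rw [growth, growth, F_pow_succ_apply, pow_succ]
  field_simp

theorem green_pow (n : ℕ) (q : ℂ × ℂ × ℂ) : S.green ((S.F ^ n) q) = (S.d : ℝ) ^ n * S.green q := by
  induction n with
  | zero => simp
  | succ n ih => rw [F_pow_succ, hR.green_F, ih, pow_succ']; ring

/-- An orbit that never escapes has `log⁺` of its norm linear in `n`, which division by `d ^ n`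
kills. -/
theorem green_eq_zero {q : ℂ × ℂ × ℂ} (hq : q ∉ S.U R) : S.green q = 0 := by
  obtain ⟨B, hB, h⟩ := hR.posLog_le {q} isCompact_singleton
  have hnot : ∀ k ≥ 1, (S.F ^ k) q ∉ S.V R := fun k hk hmem => hq ⟨k, hk, hmem⟩
  refine tendsto_nhds_unique (hR.tendsto_growth q) ?_
  have hd := S.d_pos
  have hlim : Tendsto (fun n : ℕ => (B * S.d) * (n + 1) / (S.d : ℝ) ^ (n + 1)) atTop (𝓝 0) :=
    (summable_succ_div_pow S.one_lt_d (B * S.d)).tendsto_atTop_zero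
  refine squeeze_zero (fun n => div_nonneg Real.posLog_nonneg (by positivity)) (fun n => ?_) hlim
  have h1 := h q rfl n fun k hk _ => hnot k hk
  calc S.growth n q ≤ B * (n + 1) / (S.d : ℝ) ^ n := by
        rw [growth]; gcongr
    _ = _ := by rw [pow_succ]; field_simp

/-- The terms of the series that computes the Green function in the escape region. -/
theorem norm_term_le {q : ℂ × ℂ × ℂ} (hq : q ∈ S.V R) (k : ℕ) :
    ‖((Real.log ‖S.κ‖ : ℂ) + S.logRatio ((S.F ^ k) q)) / (S.d : ℂ) ^ (k + 1)‖ ≤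
      (|Real.log ‖S.κ‖| + 1) / (S.d : ℝ) ^ (k + 1) := by
  rw [norm_div, norm_pow, Complex.norm_natCast]
  have := S.d_pos
  gcongr
  exact hR.norm_log_add_logRatio_le (hR.pow_mem hq k)

/-- Iterating `log_norm_Y_F` telescopes `d⁻ⁿ log ‖Y ∘ Fⁿ‖`. Replacing `log ‖Y‖` by `log⁺` of the
norm costs at most `log 3 / d ^ n`. -/
theorem green_eq_of_mem_V {q : ℂ × ℂ × ℂ} (hq : q ∈ S.V R) :
    S.green q = Real.log ‖S.Y q‖ + (∑' k : ℕ, ((Real.log ‖S.κ‖ : ℂ) +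
      S.logRatio ((S.F ^ k) q)) / (S.d : ℂ) ^ (k + 1)).re := by
  have hd := S.d_pos
  set T : ℕ → ℂ := fun k => ((Real.log ‖S.κ‖ : ℂ) + S.logRatio ((S.F ^ k) q)) /
    (S.d : ℂ) ^ (k + 1) with hT
  have hpart : ∀ n : ℕ, Real.log ‖S.Y ((S.F ^ n) q)‖ / (S.d : ℝ) ^ n =
      Real.log ‖S.Y q‖ + (∑ k ∈ Finset.range n, T k).re := by
    intro n
    induction n with
    | zero => simp
    | succ n ih =>
      have hre : (T n).re = ((Real.log ‖S.κ‖ : ℂ) + S.logRatio ((S.F ^ n) q)).re /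
          (S.d : ℝ) ^ (n + 1) := by
        rw [hT]
        simp only
        rw [show (S.d : ℂ) ^ (n + 1) = (((S.d : ℝ) ^ (n + 1) : ℝ) : ℂ) by push_cast; rfl,
          Complex.div_ofReal_re]
      rw [Finset.sum_range_succ, Complex.add_re, ← add_assoc, ← ih, hre, F_pow_succ,
        hR.log_norm_Y_F (hR.pow_mem hq n), pow_succ]
      field_simp
  have hsum : Summable T := Summable.of_norm_bounded S.hasSum_bound.1 (hR.norm_term_le hq)
  have h1 : Tendsto (fun n : ℕ => Real.log ‖S.Y ((S.F ^ n) q)‖ / (S.d : ℝ) ^ n) atTop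
      (𝓝 (Real.log ‖S.Y q‖ + (∑' k, T k).re)) := by
    simp only [hpart]
    exact tendsto_const_nhds.add
      ((Complex.continuous_re.tendsto _).comp hsum.hasSum.tendsto_sum_nat)
  have h2 : Tendsto (fun n : ℕ => Real.log 3 / (S.d : ℝ) ^ n) atTop (𝓝 0) :=
    tendsto_const_nhds.div_atTop (tendsto_pow_atTop_atTop_of_one_lt S.one_lt_d)
  have h3 := h1.add h2
  rw [add_zero] at h3
  refine tendsto_nhds_unique (hR.tendsto_growth q) ?_
  refine tendsto_of_tendsto_of_tendsto_of_le_of_le h1 h3 (fun n => ?_) (fun n => ?_)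
  · exact div_le_div_of_nonneg_right (hR.log_norm_Y_le (hR.pow_mem hq n)).1 (by positivity)
  · rw [growth, ← add_div]
    exact div_le_div_of_nonneg_right (hR.log_norm_Y_le (hR.pow_mem hq n)).2 (by positivity)

theorem green_pos_of_mem_V {q : ℂ × ℂ × ℂ} (hq : q ∈ S.V R) : 0 < S.green q := by
  rw [hR.green_eq_of_mem_V hq]
  have h1 := tsum_of_norm_bounded S.hasSum_bound.1.hasSum (hR.norm_term_le hq)
  have h2 := abs_le.1 (((Complex.abs_re_le_norm _).trans h1).trans S.hasSum_bound.2)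
  have h3 : Real.log R < Real.log ‖S.Y q‖ :=
    Real.log_lt_log (by linarith [hR.one_le]) (V_spec hR.one_le hq).1
  linarith [hR.lt_log, h2.1]

theorem green_pos {q : ℂ × ℂ × ℂ} (hq : q ∈ S.U R) : 0 < S.green q := by
  obtain ⟨n, _, hn⟩ := hq
  have h := hR.green_pos_of_mem_V hn
  rw [hR.green_pow] at h
  exact pos_of_mul_pos_right h (pow_pos S.d_pos n).le

theorem green_eventuallyEq_re_of_mem_V {q : ℂ × ℂ × ℂ} (hq : q ∈ S.V R) :
    ∃ Φ : ℂ × ℂ × ℂ → ℂ, ContDiffAt ℂ 2 Φ q ∧ S.green =ᶠ[𝓝 q] fun p => (Φ p).re := by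
  have hY := hR.Y_ne_zero hq
  obtain ⟨r, hr, hball⟩ := Metric.isOpen_iff.1 (isOpen_V R) q hq
  -- `log Y` need not have a branch on all of `V`; dividing by `Y q` puts the argument at `1` when
  -- `p = q`, away from the cut.
  refine ⟨fun p => (Real.log ‖S.Y q‖ : ℂ) + Complex.log (S.Y p / S.Y q) +
    ∑' k : ℕ, ((Real.log ‖S.κ‖ : ℂ) + S.logRatio ((S.F ^ k) p)) / (S.d : ℂ) ^ (k + 1), ?_, ?_⟩
  · refine ContDiffAt.add (contDiffAt_const.add ?_) ?_
    · refine ContDiffAt.comp q (g := Complex.log) (Complex.contDiffAt_log ?_)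
        (S.Y.contDiff.div_const _).contDiffAt
      rw [div_self hY]
      exact Complex.one_mem_slitPlane
    · refine contDiffAt_tsum_of_holomorphic 2 hr S.hasSum_bound.1 (fun k p hp => ?_)
        (fun k p hp => hR.norm_term_le (hball hp) k)
      have h1 : ContDiffAt ℂ (⊤ : ℕ∞) (fun p => S.logRatio ((S.F ^ k) p)) p :=
        (hR.contDiffAt_logRatio (hR.pow_mem (hball hp) k)).comp p (contDiff_pow k).contDiffAt
      exact ((contDiffAt_const.add h1).div_const _).contDiffWithinAt
  · filter_upwards [(isOpen_V R).mem_nhds hq] with p hp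
    have hYp := hR.Y_ne_zero hp
    rw [hR.green_eq_of_mem_V hp, Complex.add_re, Complex.add_re, Complex.ofReal_re,
      Complex.log_re, norm_div, Real.log_div (by positivity) (by positivity)]
    ring

theorem green_eventuallyEq_re {q : ℂ × ℂ × ℂ} (hq : q ∈ S.U R) (s : ℝ) :
    ∃ Φ : ℂ × ℂ × ℂ → ℂ, ContDiffAt ℂ 2 Φ q ∧
      (fun p => s * S.green p) =ᶠ[𝓝 q] fun p => (Φ p).re := by
  obtain ⟨n, _, hn⟩ := hq
  obtain ⟨Φ, hΦ, hG⟩ := hR.green_eventuallyEq_re_of_mem_V hn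
  have hd := pow_pos S.d_pos n
  -- Pull the local function on `V` back by `Fⁿ` and use `green ∘ Fⁿ = d ^ n green`.
  refine ⟨fun p => ((s / (S.d : ℝ) ^ n : ℝ) : ℂ) * Φ ((S.F ^ n) p), ?_, ?_⟩
  · exact contDiffAt_const.mul (hΦ.comp q (contDiff_infty.1 (contDiff_pow n) 2).contDiffAt)
  · filter_upwards [((continuous_pow n).tendsto q).eventually hG] with p hp
    rw [Complex.re_ofReal_mul, ← hp, hR.green_pow]
    field_simp

end IsEscapeRadius

/-- The properties of the Green function of an escape system, in the normalization
`lim sₙ⁻¹ log⁺ ‖Fⁿ‖` with `sₙ = d ^ n / s`. -/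
theorem exists_radius_green (S : EscapeSystem) {s : ℝ} (hs : 0 < s)
    {g : ℕ → ℂ × ℂ × ℂ → ℝ} {G : ℂ × ℂ × ℂ → ℝ}
    (hg : ∀ n ≥ 1, ∀ q, g n q = s * S.growth n q)
    (hG : ∀ q, G q = limUnder atTop fun n => g n q) :
    ∃ R₀ : ℝ, ∀ R ≥ R₀,
      (∀ Q : Set (ℂ × ℂ × ℂ), IsCompact Q → TendstoUniformlyOn g G atTop Q) ∧
        IsPlurisubharmonicOn G Set.univ ∧ IsOpen (S.U R) ∧ IsPluriharmonicOn G (S.U R) ∧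
        (∀ q, G (S.F q) = (S.d : ℝ) * G q) ∧ (∀ q ∈ S.U R, 0 < G q) ∧
        (∀ q, G q = 0 ↔ q ∉ S.U R) := by
  obtain ⟨R₀, hR₀⟩ := S.exists_isEscapeRadius
  refine ⟨R₀, fun R hRR => ?_⟩
  have hR := hR₀ R hRR
  have hG' : G = fun q => s * S.green q := by
    funext q
    rw [hG]
    refine Tendsto.limUnder_eq (((hR.tendsto_growth q).const_mul s).congr' ?_)
    filter_upwards [eventually_ge_atTop 1] with n hn
    rw [hg n hn]
  have hunif : ∀ Q : Set (ℂ × ℂ × ℂ), IsCompact Q →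
      TendstoUniformlyOn (fun n q => s * S.growth n q) G atTop Q := by
    intro Q hQ
    rw [hG']
    exact (uniformContinuous_const_smul s).comp_tendstoUniformlyOn (hR.tendstoUniformlyOn_growth hQ)
  have hpos : ∀ q ∈ S.U R, 0 < G q := fun q hq => by
    rw [hG']; exact mul_pos hs (hR.green_pos hq)
  refine ⟨fun Q hQ => (hunif Q hQ).congr ?_, ?_, isOpen_U R, ?_, fun q => ?_, hpos, fun q => ?_⟩
  · filter_upwards [eventually_ge_atTop 1] with n hn q _
    rw [hg n hn]
  · refine isPlurisubharmonicOn_univ_of_tendstoUniformlyOn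
      (fun n => continuous_const.mul (continuous_growth n)) (fun n a b => ?_) hunif
    have hline : Differentiable ℂ fun ζ : ℂ => (S.F ^ n) (a + ζ • b) :=
      ((contDiff_pow n).differentiable (by simp)).comp (by fun_prop)
    have h := posLog_euclideanNorm_le_circleAverage hline
    have hk : 0 ≤ s / (S.d : ℝ) ^ n := div_nonneg hs.le (pow_pos S.d_pos n).le
    have h' := mul_le_mul_of_nonneg_left h hk
    have hsmul := Real.circleAverage_fun_smul (a := s / (S.d : ℝ) ^ n) (c := 0) (R := 1)
      (f := fun ζ : ℂ => Real.posLog (euclideanNorm ((S.F ^ n) (a + ζ • b))))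
    simp only [smul_eq_mul] at hsmul
    rw [← hsmul] at h'
    simp only [zero_smul, add_zero] at h'
    have he : ∀ q, s * S.growth n q =
        s / (S.d : ℝ) ^ n * Real.posLog (euclideanNorm ((S.F ^ n) q)) := fun q => by
      rw [growth]; ring
    simp only [Pi.mul_apply, he]
    exact h'
  · refine isPluriharmonicOn_of_eventuallyEq_re fun a ha => ?_
    rw [hG']
    exact hR.green_eventuallyEq_re ha s
  · rw [hG']
    simp only [hR.green_F]
    ring
  · refine ⟨fun h0 hq => (hpos q hq).ne' h0, fun hq => ?_⟩
    rw [hG']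
    simp only [hR.green_eq_zero hq, mul_zero]

end EscapeSystem

/-! ### Weighted growth of compositions of Hénon maps -/

namespace HenonFactor

theorem map_fst {S : Type} [CommRing S] [Algebra ℂ S] (f : HenonFactor) (l : S) (z : S × S) :
    (f.map l z).1 = z.2 := rfl

theorem map_snd (f : HenonFactor) (l : ℂ) (z : ℂ × ℂ) :
    (f.map l z).2 =
      ∑ k ∈ Finset.range (f.p.natDegree + 1), (f.p.coeff k).eval l * z.2 ^ k - f.δ * z.1 := by
  simp [map, eval₂_eq_sum_range]

end HenonFactor

/-- The composition of the Hénon maps with parameter `l` of a list of families. -/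
def henonComp {S : Type} [CommRing S] [Algebra ℂ S] (L : List HenonFactor) (l : S) (z : S × S) :
    S × S :=
  L.foldl (fun w f => f.map l w) z

theorem henonComp_cons {S : Type} [CommRing S] [Algebra ℂ S] (f : HenonFactor)
    (L : List HenonFactor) (l : S) (z : S × S) :
    henonComp (f :: L) l z = henonComp L l (f.map l z) := rfl

theorem henonComp_concat {S : Type} [CommRing S] [Algebra ℂ S] (f : HenonFactor)
    (L : List HenonFactor) (l : S) (z : S × S) :
    henonComp (L ++ [f]) l z = f.map l (henonComp L l z) := by
  simp [henonComp]

/-- The product of the degrees of the Hénon maps of a list. -/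
def degreeProd (L : List HenonFactor) : ℕ := (L.map fun f => f.p.natDegree).prod

theorem one_le_degreeProd (L : List HenonFactor) : 1 ≤ degreeProd L := by
  induction L with
  | nil => simp [degreeProd]
  | cons f L ih =>
    have := f.two_le_natDegree
    simp only [degreeProd, List.map_cons, List.prod_cons] at ih ⊢
    exact Nat.mul_pos (by omega) ih

theorem two_le_degreeProd {L : List HenonFactor} (hL : L ≠ []) : 2 ≤ degreeProd L := by
  cases L with
  | nil => exact absurd rfl hL
  | cons f L =>
    have h1 := f.two_le_natDegree
    have h2 := one_le_degreeProd L
    simp only [degreeProd, List.map_cons, List.prod_cons] at h2 ⊢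
    nlinarith

section Growth

variable {α : Type} {F : Filter α} {ν : α → ℝ} {ℓ w : α → ℂ} {D : ℕ}

theorem isBigO_pow_of_le (hν : ∀ᶠ a in F, 1 ≤ ν a) {m n : ℕ} (h : m ≤ n) :
    (fun a => ν a ^ m) =O[F] fun a => ν a ^ n := by
  refine Asymptotics.IsBigO.of_bound 1 ?_
  filter_upwards [hν] with a ha
  have h0 : 0 ≤ ν a := by linarith
  rw [one_mul, Real.norm_of_nonneg (pow_nonneg h0 m), Real.norm_of_nonneg (pow_nonneg h0 n)]
  exact pow_le_pow_right₀ ha h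

theorem isBigO_eval (hν : ∀ᶠ a in F, 1 ≤ ν a) (hℓ : ℓ =O[F] ν) (q : ℂ[X]) {n : ℕ}
    (hq : q.natDegree ≤ n) : (fun a => q.eval (ℓ a)) =O[F] fun a => ν a ^ n := by
  simp only [eval_eq_sum_range]
  refine Asymptotics.IsBigO.fun_sum fun i hi => ?_
  have hi' : i ≤ n := by have := Finset.mem_range.1 hi; omega
  exact ((hℓ.pow i).const_mul_left _).trans (isBigO_pow_of_le hν hi')

/-- By `u ^ (d + 1) - v ^ (d + 1) = u ^ d (u - v) + (u ^ d - v ^ d) v`, the gain of one unit of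
weight survives taking powers. -/
theorem isBigO_pow_sub_pow {u v : α → ℂ} {m : ℕ} (hm : 1 ≤ m)
    (hu : u =O[F] fun a => ν a ^ m) (hv : v =O[F] fun a => ν a ^ m)
    (huv : (fun a => u a - v a) =O[F] fun a => ν a ^ (m - 1)) {d : ℕ} (hd : 1 ≤ d) :
    (fun a => u a ^ d - v a ^ d) =O[F] fun a => ν a ^ (m * d - 1) := by
  induction d, hd using Nat.le_induction with
  | base => simpa using huv
  | succ d hd ih =>
    have h1 := (hu.pow d).mul huv
    have h2 := ih.mul hv
    have hmd : 1 ≤ m * d := Nat.mul_pos hm hd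
    have e1 : ∀ a, (ν a ^ m) ^ d * ν a ^ (m - 1) = ν a ^ (m * (d + 1) - 1) := fun a => by
      rw [← pow_mul, ← pow_add]
      congr 1
      rw [mul_add, mul_one]
      omega
    have e2 : ∀ a, ν a ^ (m * d - 1) * ν a ^ m = ν a ^ (m * (d + 1) - 1) := fun a => by
      rw [← pow_add]
      congr 1
      rw [mul_add, mul_one]
      omega
    simp only [e1] at h1
    simp only [e2] at h2
    refine (h1.add h2).congr_left fun a => ?_
    ring

/-- The growth condition on a family of points of `ℂ²`, in the grading by powers of `ν`: the second
coordinate is `κ w ^ e` up to terms of lower weight. -/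
structure HasGrowth (F : Filter α) (ν : α → ℝ) (w : α → ℂ) (D e : ℕ) (κ : ℂ)
    (z : α → ℂ × ℂ) : Prop where
  fst : (fun a => (z a).1) =O[F] fun a => ν a ^ ((D + 1) * e)
  snd : (fun a => (z a).2 - κ * w a ^ e) =O[F] fun a => ν a ^ ((D + 1) * e - 1)

theorem HasGrowth.snd_isBigO (hν : ∀ᶠ a in F, 1 ≤ ν a) (hw : w =O[F] fun a => ν a ^ (D + 1))
    {e : ℕ} {κ : ℂ} {z : α → ℂ × ℂ} (h : HasGrowth F ν w D e κ z) :
    (fun a => (z a).2) =O[F] fun a => ν a ^ ((D + 1) * e) := by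
  have h1 : (fun a => κ * w a ^ e) =O[F] fun a => ν a ^ ((D + 1) * e) := by
    simp only [pow_mul]
    exact (hw.pow e).const_mul_left κ
  refine ((h.snd.trans (isBigO_pow_of_le hν (Nat.sub_le _ _))).add h1).congr_left fun a => ?_
  ring

/-- For `k < d` the term `p_k(l) y ^ k` has weight at most `D + (D + 1) e k`, which is less than `(D
+ 1) e d`: this is why the coordinates have weight `D + 1` and not `D`. The term `δ x` is of lower
weight because `d ≥ 2`. -/
theorem HasGrowth.map (hν : ∀ᶠ a in F, 1 ≤ ν a) (hℓ : ℓ =O[F] ν)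
    (hw : w =O[F] fun a => ν a ^ (D + 1)) {f : HenonFactor}
    (hf : ∀ k, (f.p.coeff k).natDegree ≤ D) {e : ℕ} (he : 1 ≤ e) {κ : ℂ} (hκ : κ ≠ 0)
    {z : α → ℂ × ℂ} (h : HasGrowth F ν w D e κ z) :
    ∃ κ' : ℂ, κ' ≠ 0 ∧ HasGrowth F ν w D (e * f.p.natDegree) κ' fun a => f.map (ℓ a) (z a) := by
  obtain ⟨b, hb, hlead⟩ := f.leadingCoeff_const
  set d := f.p.natDegree with hd
  have hd2 : 2 ≤ d := f.two_le_natDegree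
  have hz := h.snd_isBigO hν hw
  have hDe : 1 ≤ (D + 1) * e := Nat.mul_pos (by omega) he
  refine ⟨b * κ ^ d, mul_ne_zero hb (pow_ne_zero _ hκ), ?_, ?_⟩
  · simp only [HenonFactor.map_fst]
    refine hz.trans (isBigO_pow_of_le hν ?_)
    gcongr
    nlinarith
  · have hκw : (fun a => κ * w a ^ e) =O[F] fun a => ν a ^ ((D + 1) * e) := by
      simp only [pow_mul]
      exact (hw.pow e).const_mul_left κ
    have h1 := (isBigO_pow_sub_pow hDe hz hκw h.snd (d := d) (by omega)).const_mul_left b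
    have h2 : (fun a => ∑ k ∈ Finset.range d, (f.p.coeff k).eval (ℓ a) * (z a).2 ^ k) =O[F]
        fun a => ν a ^ ((D + 1) * e * d - 1) := by
      refine Asymptotics.IsBigO.fun_sum fun k hk => ?_
      have hkd : k + 1 ≤ d := Finset.mem_range.1 hk
      have h3 := (isBigO_eval hν hℓ (f.p.coeff k) (hf k)).mul (hz.pow k)
      simp only [← pow_mul, ← pow_add] at h3
      refine h3.trans (isBigO_pow_of_le hν ?_)
      have h4 : (D + 1) * e * (k + 1) ≤ (D + 1) * e * d := Nat.mul_le_mul_left _ hkd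
      have h5 : D + 1 ≤ (D + 1) * e := Nat.le_mul_of_pos_right _ he
      rw [mul_add, mul_one] at h4
      omega
    have h3 : (fun a => f.δ * (z a).1) =O[F] fun a => ν a ^ ((D + 1) * e * d - 1) := by
      refine (h.fst.const_mul_left _).trans (isBigO_pow_of_le hν ?_)
      have h4 : (D + 1) * e * 2 ≤ (D + 1) * e * d := Nat.mul_le_mul_left _ hd2
      omega
    rw [← mul_assoc]
    refine ((h1.add h2).sub h3).congr_left fun a => ?_
    have hc : (f.p.coeff d).eval (ℓ a) = b := by
      rw [hd, coeff_natDegree, hlead, eval_C]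
    rw [HenonFactor.map_snd, ← hd, Finset.sum_range_succ, hc]
    ring

theorem HasGrowth.henonComp (hν : ∀ᶠ a in F, 1 ≤ ν a) (hℓ : ℓ =O[F] ν)
    (hw : w =O[F] fun a => ν a ^ (D + 1)) (L : List HenonFactor) :
    (∀ f ∈ L, ∀ k, (f.p.coeff k).natDegree ≤ D) → ∀ {e : ℕ}, 1 ≤ e → ∀ {κ : ℂ}, κ ≠ 0 →
    ∀ {z : α → ℂ × ℂ}, HasGrowth F ν w D e κ z →
    ∃ κ' : ℂ, κ' ≠ 0 ∧
      HasGrowth F ν w D (e * degreeProd L) κ' fun a => henonComp L (ℓ a) (z a) := by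
  induction L with
  | nil =>
    intro _ e he κ hκ z h
    exact ⟨κ, hκ, by simpa [degreeProd, _root_.henonComp] using h⟩
  | cons f L ih =>
    intro hL e he κ hκ z h
    obtain ⟨κ₁, hκ₁, h₁⟩ := h.map hν hℓ hw (hL f (by simp)) he hκ
    have he₁ : 1 ≤ e * f.p.natDegree :=
      Nat.mul_pos he (by have := f.two_le_natDegree; omega)
    obtain ⟨κ₂, hκ₂, h₂⟩ := ih (fun g hg => hL g (by simp [hg])) he₁ hκ₁ h₁
    refine ⟨κ₂, hκ₂, ?_⟩
    simpa only [degreeProd, List.map_cons, List.prod_cons, mul_assoc, henonComp_cons] using h₂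

/-- The growth of a nonempty composition of Hénon maps: the second coordinate is asymptotic to
`κ w ^ d`, and the first coordinate is of lower weight. -/
theorem exists_henonComp_isBigO (hν : ∀ᶠ a in F, 1 ≤ ν a) (hℓ : ℓ =O[F] ν)
    (hw : w =O[F] fun a => ν a ^ (D + 1)) {L : List HenonFactor} (hL : L ≠ [])
    (hdeg : ∀ f ∈ L, ∀ k, (f.p.coeff k).natDegree ≤ D) {z : α → ℂ × ℂ}
    (hz₁ : (fun a => (z a).1) =O[F] fun a => ν a ^ (D + 1))
    (hz₂ : (fun a => (z a).2 - w a) =O[F] fun a => ν a ^ D) :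
    ∃ κ : ℂ, κ ≠ 0 ∧
      (fun a => (henonComp L (ℓ a) (z a)).1) =O[F] (fun a => ν a ^ ((D + 1) * degreeProd L - 1)) ∧
      (fun a => (henonComp L (ℓ a) (z a)).2 - κ * w a ^ degreeProd L) =O[F]
        (fun a => ν a ^ ((D + 1) * degreeProd L - 1)) := by
  have hz : HasGrowth F ν w D 1 1 z := ⟨by simpa using hz₁, by simpa using hz₂⟩
  obtain ⟨κ, hκ, h⟩ := hz.henonComp hν hℓ hw L hdeg le_rfl one_ne_zero
  rw [one_mul] at h
  refine ⟨κ, hκ, ?_, h.snd⟩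
  -- The first coordinate is the second coordinate before the last factor, whose degree is smaller
  -- by a factor of at least `2`.
  obtain rfl | ⟨L', f, rfl⟩ := L.eq_nil_or_concat
  · exact absurd rfl hL
  · obtain ⟨κ', _, h'⟩ := hz.henonComp hν hℓ hw L' (fun g hg => hdeg g (by simp [hg])) le_rfl
      one_ne_zero
    rw [one_mul] at h'
    simp only [List.concat_eq_append, henonComp_concat, HenonFactor.map_fst]
    refine (h'.snd_isBigO hν hw).trans (isBigO_pow_of_le hν ?_)
    have h1 : degreeProd (L' ++ [f]) = degreeProd L' * f.p.natDegree := by simp [degreeProd]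
    have h2 : (D + 1) * degreeProd L' * 2 ≤ (D + 1) * degreeProd L' * f.p.natDegree :=
      Nat.mul_le_mul_left _ f.two_le_natDegree
    have h3 : 1 ≤ (D + 1) * degreeProd L' := Nat.mul_pos (by omega) (one_le_degreeProd L')
    rw [h1, ← mul_assoc]
    omega

end Growth

/-! ### Recentring a composition of Hénon maps along an orbit -/

/-- Naturality in the algebra: this links the map on complex points with its versions on polynomials
in the parameter and on indeterminates. -/
theorem HenonFactor.prodMap_map {S S' : Type} [CommRing S] [Algebra ℂ S] [CommRing S']
    [Algebra ℂ S'] (φ : S →ₐ[ℂ] S') (f : HenonFactor) (l : S) (z : S × S) :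
    Prod.map φ φ (f.map l z) = f.map (φ l) (Prod.map φ φ z) := by
  have h : φ.toRingHom.comp (aeval l : ℂ[X] →ₐ[ℂ] S).toRingHom =
      (aeval (φ l) : ℂ[X] →ₐ[ℂ] S').toRingHom := by
    have : φ.comp (aeval l) = aeval (φ l) := by ext; simp
    rw [← this]; rfl
  have h2 := hom_eval₂ f.p (aeval l : ℂ[X] →ₐ[ℂ] S).toRingHom φ.toRingHom z.2
  rw [h] at h2
  ext
  · rfl
  · simp only [HenonFactor.map, Prod.map_snd, map_sub, map_mul, AlgHom.commutes, Prod.map_fst]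
    exact congrArg (fun a => a - algebraMap ℂ S' f.δ * φ z.1) h2

theorem prodMap_henonComp {S S' : Type} [CommRing S] [Algebra ℂ S] [CommRing S'] [Algebra ℂ S']
    (φ : S →ₐ[ℂ] S') (L : List HenonFactor) (l : S) (z : S × S) :
    Prod.map φ φ (henonComp L l z) = henonComp L (φ l) (Prod.map φ φ z) := by
  induction L generalizing z with
  | nil => rfl
  | cons f L ih => rw [henonComp_cons, henonComp_cons, ih, f.prodMap_map]

namespace HenonFactor

theorem natDegree_recenter (f : HenonFactor) (t : ℂ[X]) :
    (taylor t f.p - C (f.p.eval t)).natDegree = f.p.natDegree := by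
  rw [natDegree_sub_C, natDegree_taylor]

/-- The family of Hénon maps with polynomial `p(y + t) - p(t)`. -/
def recenter (f : HenonFactor) (t : ℂ[X]) : HenonFactor where
  p := taylor t f.p - C (f.p.eval t)
  δ := f.δ
  δ_ne_zero := f.δ_ne_zero
  two_le_natDegree := by
    rw [natDegree_recenter]; exact f.two_le_natDegree
  leadingCoeff_const := by
    obtain ⟨a, ha, h⟩ := f.leadingCoeff_const
    refine ⟨a, ha, ?_⟩
    have h2 := f.two_le_natDegree
    have h3 : (taylor t f.p).coeff f.p.natDegree = C a := by
      rw [← h, ← leadingCoeff_taylor t f.p, leadingCoeff, natDegree_taylor]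
    rw [leadingCoeff, natDegree_recenter, coeff_sub, h3, coeff_C, if_neg (by omega), sub_zero]

theorem recenter_coeff_zero (f : HenonFactor) (t : ℂ[X]) : (f.recenter t).p.coeff 0 = 0 := by
  simp [recenter, taylor_coeff_zero]

/-- Translating the source by `t` and the target by the image of `t` replaces `p(y)` by `p(y + t) -
p(t)`, which fixes the origin. -/
theorem map_recenter {S : Type} [CommRing S] [Algebra ℂ S] (f : HenonFactor) (l : S)
    (t : ℂ[X] × ℂ[X]) (z : S × S) :
    f.map l (z + Prod.map (aeval l : ℂ[X] →ₐ[ℂ] S) (aeval l : ℂ[X] →ₐ[ℂ] S) t) =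
      (f.recenter t.2).map l z +
        Prod.map (aeval l : ℂ[X] →ₐ[ℂ] S) (aeval l : ℂ[X] →ₐ[ℂ] S) (f.map X t) := by
  rw [prodMap_map, aeval_X]
  ext
  · rfl
  · have h : eval₂ (aeval l : ℂ[X] →ₐ[ℂ] S).toRingHom (aeval l t.2) f.p =
        aeval l (f.p.eval t.2) := eval₂_at_apply (aeval l : ℂ[X] →ₐ[ℂ] S).toRingHom t.2
    have h' : (aeval l : ℂ[X] →ₐ[ℂ] S).toRingHom t.2 = aeval l t.2 := rfl
    have h'' : (aeval l : ℂ[X] →ₐ[ℂ] S).toRingHom (f.p.eval t.2) = aeval l (f.p.eval t.2) := rfl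
    simp only [map, recenter, Prod.snd_add, Prod.map_snd, Prod.fst_add, Prod.map_fst,
      taylor_apply, eval₂_sub, eval₂_comp, eval₂_add, eval₂_X, eval₂_C, h, h', h'']
    ring

end HenonFactor

/-- The list of Hénon families recentred along the orbit of the point `t`. -/
def recenterList : List HenonFactor → ℂ[X] × ℂ[X] → List HenonFactor
  | [], _ => []
  | f :: L, t => f.recenter t.2 :: recenterList L (f.map X t)

theorem coeff_zero_of_mem_recenterList (L : List HenonFactor) (t : ℂ[X] × ℂ[X]) :
    ∀ f ∈ recenterList L t, f.p.coeff 0 = 0 := by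
  induction L generalizing t with
  | nil => simp [recenterList]
  | cons f L ih =>
    intro g hg
    rcases List.mem_cons.1 hg with rfl | hg
    · exact f.recenter_coeff_zero _
    · exact ih _ g hg

theorem degreeProd_recenterList (L : List HenonFactor) (t : ℂ[X] × ℂ[X]) :
    degreeProd (recenterList L t) = degreeProd L := by
  induction L generalizing t with
  | nil => rfl
  | cons f L ih =>
    have h := ih (f.map X t)
    have h' : (f.recenter t.2).p.natDegree = f.p.natDegree := f.natDegree_recenter t.2
    simp only [degreeProd] at h
    simp [degreeProd, recenterList, h, h']

theorem recenterList_ne_nil {L : List HenonFactor} (hL : L ≠ []) (t : ℂ[X] × ℂ[X]) :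
    recenterList L t ≠ [] := by
  cases L with
  | nil => exact absurd rfl hL
  | cons f L => simp [recenterList]

theorem henonComp_recenterList {S : Type} [CommRing S] [Algebra ℂ S] (L : List HenonFactor)
    (l : S) (t : ℂ[X] × ℂ[X]) (z : S × S) :
    henonComp L l (z + Prod.map (aeval l : ℂ[X] →ₐ[ℂ] S) (aeval l : ℂ[X] →ₐ[ℂ] S) t) =
      henonComp (recenterList L t) l z +
        Prod.map (aeval l : ℂ[X] →ₐ[ℂ] S) (aeval l : ℂ[X] →ₐ[ℂ] S) (henonComp L X t) := by
  induction L generalizing t z with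
  | nil => rfl
  | cons f L ih =>
    rw [henonComp_cons, f.map_recenter, ih, recenterList, henonComp_cons, henonComp_cons]

/-! ### Degrees in the parameter -/

/-- The roles of the variables are exchanged: in the ring of values the outer variable is the
parameter, whereas in `p` the parameter is the inner one. -/
theorem aeval_X_eq_map (b : ℂ[X]) : aeval (X : ℂ[X][X]) b = b.map (C : ℂ →+* ℂ[X]) := rfl

/-- If `u` is nonzero and all its coefficients vanish at `0`, no cancellation of the highest power
of the outer variable occurs in `p(u)`. -/
theorem natDegree_coeff_add_le_natDegree_eval₂ (p : ℂ[X][X]) {u : ℂ[X][X]} (hu : u ≠ 0)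
    (hu0 : u.map (evalRingHom (0 : ℂ)) = 0) {k : ℕ} (hk : p.coeff k ≠ 0) :
    (p.coeff k).natDegree + k * u.natDegree ≤
      (p.eval₂ (aeval (X : ℂ[X][X]) : ℂ[X] →ₐ[ℂ] ℂ[X][X]).toRingHom u).natDegree := by
  set e := u.natDegree with he
  set g := u.leadingCoeff with hg
  have hg0 : g.coeff 0 = 0 := by
    have := congrArg (fun r => r.coeff e) hu0
    rw [coeff_map, coeff_zero] at this
    rw [coeff_zero_eq_eval_zero]
    exact this
  have hgne : g ≠ 0 := leadingCoeff_ne_zero.2 hu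
  -- `W` is the largest degree that a term of `p(u)` can have. The coefficient at `W` will be `q ∘
  -- g`, with `q ≠ 0` because of the index `k₀`, and `g` nonconstant since it is nonzero and
  -- vanishes at `0`.
  obtain ⟨k₀, hk₀, hmax⟩ := p.support.exists_max_image
    (fun k => (p.coeff k).natDegree + k * e) ⟨k, mem_support_iff.2 hk⟩
  set W := (p.coeff k₀).natDegree + k₀ * e with hW
  have hle : ∀ j, p.coeff j ≠ 0 → (p.coeff j).natDegree + j * e ≤ W := fun j hj =>
    hmax j (mem_support_iff.2 hj)
  refine (hle k hk).trans (le_natDegree_of_ne_zero ?_)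
  set q : ℂ[X] := ∑ j ∈ Finset.range (p.natDegree + 1), monomial j ((p.coeff j).coeff (W - j * e))
    with hq
  have hterm : ∀ j, ((aeval (X : ℂ[X][X]) (p.coeff j)) * u ^ j).coeff W =
      C ((p.coeff j).coeff (W - j * e)) * g ^ j := by
    intro j
    by_cases hj : p.coeff j = 0
    · simp [hj]
    · have h1 := hle j hj
      have h2 : W = (W - j * e) + j * e := by omega
      have h3 : (aeval (X : ℂ[X][X]) (p.coeff j)).natDegree ≤ W - j * e := by
        rw [aeval_X_eq_map]
        exact natDegree_map_le.trans (by omega)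
      have h4 : (u ^ j).natDegree ≤ j * e := natDegree_pow_le
      conv_lhs => rw [h2]
      rw [coeff_mul_add_eq_of_natDegree_le h3 h4, aeval_X_eq_map, coeff_map, he,
        coeff_pow_mul_natDegree]
  have hcoeff : (p.eval₂ (aeval (X : ℂ[X][X]) : ℂ[X] →ₐ[ℂ] ℂ[X][X]).toRingHom u).coeff W =
      q.comp g := by
    rw [eval₂_eq_sum_range, finsetSum_coeff, hq, comp, eval₂_finsetSum]
    refine Finset.sum_congr rfl fun j _ => ?_
    rw [eval₂_monomial]
    exact hterm j
  rw [hcoeff, Ne, comp_eq_zero_iff, hg0, C_0]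
  rintro (h | ⟨_, h⟩)
  · have hk₀' : k₀ ∈ Finset.range (p.natDegree + 1) :=
      Finset.mem_range.2 (Nat.lt_succ_of_le (le_natDegree_of_mem_supp _ hk₀))
    have h1 := congrArg (fun r => r.coeff k₀) h
    simp only [hq, finsetSum_coeff, coeff_monomial, coeff_zero] at h1
    rw [Finset.sum_ite_eq_of_mem' _ _ _ hk₀', hW, Nat.add_sub_cancel] at h1
    exact mem_support_iff.1 hk₀ (leadingCoeff_eq_zero.1 h1)
  · exact hgne h

/-- The condition on the pair `z`, preserved by Hénon maps that fix the origin, under which the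
degree in the outer variable does not decrease. -/
structure DegreeOrdered (z : ℂ[X][X] × ℂ[X][X]) : Prop where
  fst_map : z.1.map (evalRingHom (0 : ℂ)) = 0
  snd_map : z.2.map (evalRingHom (0 : ℂ)) = 0
  natDegree_le : z.1.natDegree ≤ z.2.natDegree
  natDegree_eval_lt : (z.1.eval 0).natDegree < (z.2.eval 0).natDegree

theorem natDegree_algebraMap_mul_le (a : ℂ) (u : ℂ[X][X]) :
    (algebraMap ℂ ℂ[X][X] a * u).natDegree ≤ u.natDegree :=
  natDegree_C_mul_le (C a) u

/-- The polynomial `p(z.2)` has at least twice the degree of `z.2` in the parameter and dominates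
the degrees of all coefficients of `p`. Setting the parameter to `0` multiplies the degree in the
inner variable by `deg p`, which keeps the second entry nonzero. -/
theorem DegreeOrdered.map {z : ℂ[X][X] × ℂ[X][X]} (hz : DegreeOrdered z) (f : HenonFactor)
    (hf : f.p.coeff 0 = 0) : DegreeOrdered (f.map X z) ∧
      ∀ k, (f.p.coeff k).natDegree ≤ (f.map X z).2.natDegree := by
  set P := f.p.eval₂ (aeval (X : ℂ[X][X]) : ℂ[X] →ₐ[ℂ] ℂ[X][X]).toRingHom z.2 with hP
  have hsnd : (f.map X z).2 = P - algebraMap ℂ ℂ[X][X] f.δ * z.1 := rfl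
  have hd2 := f.two_le_natDegree
  have hv : z.2 ≠ 0 := by
    intro h
    have := hz.natDegree_eval_lt
    simp [h] at this
  have hkey : ∀ k, f.p.coeff k ≠ 0 → (f.p.coeff k).natDegree + k * z.2.natDegree ≤ P.natDegree :=
    fun k hk => natDegree_coeff_add_le_natDegree_eval₂ f.p hv hz.snd_map hk
  have hlead : f.p.coeff f.p.natDegree ≠ 0 := by
    rw [coeff_natDegree, Ne, leadingCoeff_eq_zero]
    rintro h
    simp [h] at hd2
  have hP2 : 2 * z.2.natDegree ≤ P.natDegree := by
    have h1 := hkey _ hlead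
    have h2 : 2 * z.2.natDegree ≤ f.p.natDegree * z.2.natDegree := Nat.mul_le_mul_right _ hd2
    omega
  have hPk : ∀ k, (f.p.coeff k).natDegree ≤ P.natDegree := by
    intro k
    by_cases hk : f.p.coeff k = 0
    · simp [hk]
    · have := hkey k hk
      omega
  have hδ := natDegree_algebraMap_mul_le f.δ z.1
  have hle := hz.natDegree_le
  have hw : z.2.natDegree ≤ (f.map X z).2.natDegree ∧ P.natDegree ≤ (f.map X z).2.natDegree := by
    rw [hsnd]
    -- If `δ x` does not have smaller degree, then `2 deg z.2 ≤ deg P ≤ deg z.1 ≤ deg z.2`, so all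
    -- these degrees are `0`.
    by_cases h : (algebraMap ℂ ℂ[X][X] f.δ * z.1).natDegree < P.natDegree
    · rw [natDegree_sub_eq_left_of_natDegree_lt h]
      omega
    · omega
  refine ⟨⟨hz.snd_map, ?_, hw.1, ?_⟩, fun k => (hPk k).trans hw.2⟩
  · rw [hsnd, Polynomial.map_sub, Polynomial.map_mul, hz.fst_map, mul_zero, sub_zero, hP]
    have := hom_eval₂ f.p (aeval (X : ℂ[X][X]) : ℂ[X] →ₐ[ℂ] ℂ[X][X]).toRingHom
      (mapRingHom (evalRingHom (0 : ℂ))) z.2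
    rw [coe_mapRingHom, hz.snd_map, eval₂_at_zero, hf, map_zero] at this
    exact this
  · rw [HenonFactor.map_fst, hsnd]
    have hcomp : (evalRingHom (0 : ℂ[X])).comp
        (aeval (X : ℂ[X][X]) : ℂ[X] →ₐ[ℂ] ℂ[X][X]).toRingHom =
        (C : ℂ →+* ℂ[X]).comp (evalRingHom (0 : ℂ)) := by
      ext <;> simp
    have hPe : P.eval 0 = (f.p.map (evalRingHom (0 : ℂ))).comp (z.2.eval 0) := by
      have := hom_eval₂ f.p (aeval (X : ℂ[X][X]) : ℂ[X] →ₐ[ℂ] ℂ[X][X]).toRingHom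
        (evalRingHom (0 : ℂ[X])) z.2
      rw [hcomp] at this
      rw [comp, eval₂_map]
      exact this
    obtain ⟨a, ha, hfa⟩ := f.leadingCoeff_const
    have hdeg : (f.p.map (evalRingHom (0 : ℂ))).natDegree = f.p.natDegree := by
      refine natDegree_map_of_leadingCoeff_ne_zero _ ?_
      simpa [hfa] using ha
    have hPdeg : (P.eval 0).natDegree = f.p.natDegree * (z.2.eval 0).natDegree := by
      rw [hPe, natDegree_comp, hdeg]
    have hlt := hz.natDegree_eval_lt
    have hδe : ((algebraMap ℂ ℂ[X][X] f.δ * z.1).eval 0).natDegree ≤ (z.1.eval 0).natDegree := by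
      rw [eval_mul, show (algebraMap ℂ ℂ[X][X] f.δ).eval 0 = C f.δ from eval_C]
      exact natDegree_C_mul_le _ _
    have h2 : 2 * (z.2.eval 0).natDegree ≤ f.p.natDegree * (z.2.eval 0).natDegree :=
      Nat.mul_le_mul_right _ hd2
    rw [eval_sub, natDegree_sub_eq_left_of_natDegree_lt (by omega)]
    omega

theorem DegreeOrdered.natDegree_coeff_le {z : ℂ[X][X] × ℂ[X][X]} (hz : DegreeOrdered z)
    (L : List HenonFactor) (hL : ∀ f ∈ L, f.p.coeff 0 = 0) :
    z.2.natDegree ≤ (henonComp L X z).2.natDegree ∧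
      ∀ f ∈ L, ∀ k, (f.p.coeff k).natDegree ≤ (henonComp L X z).2.natDegree := by
  induction L generalizing z with
  | nil => simp [henonComp]
  | cons f L ih =>
    obtain ⟨h1, h2⟩ := hz.map f (hL f (by simp))
    obtain ⟨h3, h4⟩ := ih h1 fun g hg => hL g (by simp [hg])
    rw [henonComp_cons]
    refine ⟨h1.natDegree_le.trans h3, fun g hg k => ?_⟩
    rcases List.mem_cons.1 hg with rfl | hg
    · exact (h2 k).trans h3
    · exact h4 g hg k

theorem natDegree_aeval_le_totalDegree {R : Type} [CommRing R] [Algebra ℂ R]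
    (P : MvPolynomial (Fin 3) ℂ) (v : Fin 3 → R[X]) (hv : ∀ i, (v i).natDegree ≤ 1) :
    (MvPolynomial.aeval v P).natDegree ≤ P.totalDegree := by
  rw [MvPolynomial.aeval_def, MvPolynomial.eval₂_eq]
  refine natDegree_sum_le_of_forall_le _ _ fun s hs => ?_
  refine (natDegree_C_mul_le _ _).trans ((natDegree_prod_le _ _).trans ?_)
  refine le_trans (Finset.sum_le_sum fun i _ => ?_) (MvPolynomial.le_totalDegree hs)
  exact natDegree_pow_le.trans (by nlinarith [hv i])

namespace SkewHenon

theorem polys_apply {S : Type} [CommRing S] [Algebra ℂ S] (H : SkewHenon) (v : Fin 3 → S) :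
    (MvPolynomial.aeval v H.polys.1, MvPolynomial.aeval v H.polys.2) =
      henonComp H.factors (v 0) (v 1, v 2) := by
  have := prodMap_henonComp (MvPolynomial.aeval v) H.factors (MvPolynomial.X 0)
    (MvPolynomial.X 1, MvPolynomial.X 2)
  simp only [Prod.map_apply, MvPolynomial.aeval_X] at this
  exact this

theorem natDegree_henonComp_le {R : Type} [CommRing R] [Algebra ℂ R] (H : SkewHenon)
    (v : Fin 3 → R[X]) (hv : ∀ i, (v i).natDegree ≤ 1) :
    (henonComp H.factors (v 0) (v 1, v 2)).1.natDegree ≤ H.totalDegree ∧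
      (henonComp H.factors (v 0) (v 1, v 2)).2.natDegree ≤ H.totalDegree := by
  rw [← H.polys_apply v]
  exact ⟨(natDegree_aeval_le_totalDegree _ v hv).trans (le_max_left _ _),
    (natDegree_aeval_le_totalDegree _ v hv).trans (le_max_right _ _)⟩

/-- The orbit of the origin, as a pair of polynomials in the parameter. -/
def originImage (H : SkewHenon) : ℂ[X] × ℂ[X] := henonComp H.factors X (0, 0)

/-- The factors of `H_l`, recentred along the orbit of the origin. -/
def centered (H : SkewHenon) : SkewHenon where
  c := H.c
  c_ne_zero := H.c_ne_zero
  factors := recenterList H.factors (0, 0)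
  factors_ne_nil := recenterList_ne_nil H.factors_ne_nil _

theorem natDegree_originImage_le (H : SkewHenon) :
    H.originImage.1.natDegree ≤ H.totalDegree ∧ H.originImage.2.natDegree ≤ H.totalDegree :=
  H.natDegree_henonComp_le ![X, 0, 0] (by intro i; fin_cases i <;> simp)

theorem henonComp_eq_centered {S : Type} [CommRing S] [Algebra ℂ S] (H : SkewHenon) (l : S)
    (z : S × S) : henonComp H.factors l z = henonComp H.centered.factors l z +
      (aeval l H.originImage.1, aeval l H.originImage.2) := by
  have := henonComp_recenterList H.factors l (0, 0) z
  rw [show Prod.map (aeval l : ℂ[X] →ₐ[ℂ] S) (aeval l : ℂ[X] →ₐ[ℂ] S) (0, 0) = 0 by simp,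
    add_zero] at this
  exact this

/-- Follow the point `(0, y)` with `y` an indeterminate. Its image under the centred composition is
its image under `H_l` minus that of the origin, so its second entry has degree at most `d̃` in the
parameter; degrees never drop along the way, so each coefficient obeys the same bound. -/
theorem natDegree_coeff_centered_le (H : SkewHenon) : ∀ f ∈ H.centered.factors, ∀ k,
    (f.p.coeff k).natDegree ≤ H.totalDegree := by
  have hz : DegreeOrdered (0, C X) := ⟨by simp, by simp, by simp, by simp⟩
  intro f hf k
  refine ((hz.natDegree_coeff_le _ (coeff_zero_of_mem_recenterList _ _)).2 f hf k).trans ?_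
  have h1 := congrArg Prod.snd (H.henonComp_eq_centered (X : ℂ[X][X]) (0, C X))
  have h2 := (H.natDegree_henonComp_le (R := ℂ[X]) ![X, 0, C X]
    (by intro i; fin_cases i <;> simp)).2
  have h3 : (aeval (X : ℂ[X][X]) H.originImage.2).natDegree ≤ H.totalDegree := by
    rw [aeval_X_eq_map]
    exact natDegree_map_le.trans H.natDegree_originImage_le.2
  rw [Prod.snd_add, ← sub_eq_iff_eq_add] at h1
  change (henonComp H.centered.factors (X : ℂ[X][X]) (0, C X)).2.natDegree ≤ _
  rw [← h1]
  exact (natDegree_sub_le _ _).trans (max_le h2 h3)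

theorem fiberMap_eq_centered (H : SkewHenon) (l : ℂ) (z : ℂ × ℂ) :
    H.fiberMap l z = H.centered.fiberMap l z +
      (H.originImage.1.eval l, H.originImage.2.eval l) := by
  have := H.henonComp_eq_centered l z
  simp only [coe_aeval_eq_eval] at this
  exact this

theorem fiberInvMap_eq_centered (H : SkewHenon) (l : ℂ) (z : ℂ × ℂ) :
    H.fiberInvMap l z = H.centered.fiberInvMap l
      (z - (H.originImage.1.eval l, H.originImage.2.eval l)) := by
  set w := H.centered.fiberInvMap l (z - (H.originImage.1.eval l, H.originImage.2.eval l)) with hw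
  have h : H.fiberMap l w = z := by
    rw [fiberMap_eq_centered, hw, fiberMap_fiberInvMap, sub_add_cancel]
  rw [← h, fiberInvMap_fiberMap]

/-- Otherwise `H_0` would be constant, contradicting injectivity. -/
theorem totalDegree_pos (H : SkewHenon) : 0 < H.totalDegree := by
  by_contra! h
  have h1 : H.polys.1.totalDegree = 0 := by unfold totalDegree at h; omega
  have h2 : H.polys.2.totalDegree = 0 := by unfold totalDegree at h; omega
  rw [MvPolynomial.totalDegree_eq_zero_iff_eq_C] at h1 h2
  have hconst : ∀ z : ℂ × ℂ, H.fiberMap 0 z =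
      (MvPolynomial.coeff 0 H.polys.1, MvPolynomial.coeff 0 H.polys.2) := by
    intro z
    have := H.polys_apply ![(0 : ℂ), z.1, z.2]
    rw [h1, h2] at this
    simp only [MvPolynomial.aeval_C, Algebra.algebraMap_self, RingHom.id_apply] at this
    exact this.symm
  have h3 := congrArg (H.fiberInvMap 0) ((hconst (0, 0)).trans (hconst (1, 0)).symm)
  simp [fiberInvMap_fiberMap] at h3

end SkewHenon

/-! ### Inverses of Hénon maps -/

namespace HenonFactor

/-- The inverse of a Hénon map, conjugated by the exchange of the coordinates, is a Hénon map. -/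
def swapInv (f : HenonFactor) : HenonFactor where
  p := C (C f.δ⁻¹) * f.p
  δ := f.δ⁻¹
  δ_ne_zero := inv_ne_zero f.δ_ne_zero
  two_le_natDegree := by
    rw [natDegree_C_mul (by simpa using f.δ_ne_zero)]
    exact f.two_le_natDegree
  leadingCoeff_const := by
    obtain ⟨a, ha, h⟩ := f.leadingCoeff_const
    refine ⟨f.δ⁻¹ * a, mul_ne_zero (inv_ne_zero f.δ_ne_zero) ha, ?_⟩
    rw [leadingCoeff_mul, leadingCoeff_C, h, C_mul]

theorem natDegree_swapInv (f : HenonFactor) : f.swapInv.p.natDegree = f.p.natDegree :=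
  natDegree_C_mul (by simpa using f.δ_ne_zero)

theorem natDegree_coeff_swapInv_le (f : HenonFactor) (k : ℕ) :
    (f.swapInv.p.coeff k).natDegree ≤ (f.p.coeff k).natDegree := by
  rw [swapInv, coeff_C_mul]
  exact natDegree_C_mul_le _ _

theorem swapInv_map (f : HenonFactor) (l : ℂ) (z : ℂ × ℂ) :
    f.swapInv.map l z = (f.invMap l z.swap).swap := by
  ext
  · rfl
  · simp [swapInv, map, invMap]
    ring

end HenonFactor

theorem henonComp_reverse_swapInv (L : List HenonFactor) (l : ℂ) (z : ℂ × ℂ) :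
    henonComp (L.reverse.map HenonFactor.swapInv) l z.swap =
      (L.foldr (fun f w => f.invMap l w) z).swap := by
  induction L with
  | nil => rfl
  | cons f L ih =>
    rw [List.reverse_cons, List.map_append, List.map_singleton, henonComp_concat, ih,
      f.swapInv_map, Prod.swap_swap, List.foldr_cons]

theorem degreeProd_reverse_swapInv (L : List HenonFactor) :
    degreeProd (L.reverse.map HenonFactor.swapInv) = degreeProd L := by
  simp only [degreeProd, List.map_map, Function.comp_def, HenonFactor.natDegree_swapInv,
    List.map_reverse, List.prod_reverse]

/-! ### The escape systems of a skew product of Hénon maps and of its inverse -/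

theorem contDiff_henonComp {E : Type*} [NormedAddCommGroup E] [NormedSpace ℂ E]
    {n : WithTop ℕ∞} {ℓ : E → ℂ} {z : E → ℂ × ℂ} (hℓ : ContDiff ℂ n ℓ) (hz : ContDiff ℂ n z)
    (L : List HenonFactor) : ContDiff ℂ n fun q => henonComp L (ℓ q) (z q) := by
  induction L generalizing z with
  | nil => exact hz
  | cons f L ih =>
    simp only [henonComp_cons]
    refine ih (hz.snd.prodMk ?_)
    have : (fun q => (f.map (ℓ q) (z q)).2) = fun q => ∑ k ∈ Finset.range (f.p.natDegree + 1),
        (f.p.coeff k).eval (ℓ q) * (z q).2 ^ k - f.δ * (z q).1 := funext fun q => f.map_snd _ _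
    change ContDiff ℂ n fun q => (f.map (ℓ q) (z q)).2
    rw [this]
    refine (ContDiff.sum fun k _ => ?_).sub (contDiff_const.mul hz.fst)
    have hq : ContDiff ℂ n fun l : ℂ => (f.p.coeff k).eval l := by
      simpa using (f.p.coeff k).contDiff_aeval (𝕜 := ℂ) (R := ℂ) n
    exact (hq.comp hℓ).mul (hz.snd.pow k)

/-- The set on which weighted growth is measured: the parameter has weight `1`, the two other
coordinates have weight `D + 1`. -/
def weightedSet (D : ℕ) : Set ((ℂ × ℂ × ℂ) × ℝ) :=
  {a | 1 ≤ a.2 ∧ ‖a.1.1‖ ≤ a.2 ∧ ‖a.1.2.1‖ ≤ a.2 ^ (D + 1) ∧ ‖a.1.2.2‖ ≤ a.2 ^ (D + 1)}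

theorem exists_bound_of_isBigO_weightedSet {D n : ℕ} {f g : ℂ × ℂ × ℂ → ℂ}
    (hf : (fun a : (ℂ × ℂ × ℂ) × ℝ => f a.1) =O[𝓟 (weightedSet D)] fun a => a.2 ^ n)
    (hg : (fun a : (ℂ × ℂ × ℂ) × ℝ => g a.1) =O[𝓟 (weightedSet D)] fun a => a.2 ^ n) :
    ∃ C : ℝ, ∀ q (ν : ℝ), 1 ≤ ν → ‖q.1‖ ≤ ν → ‖q.2.1‖ ≤ ν ^ (D + 1) → ‖q.2.2‖ ≤ ν ^ (D + 1) →
      ‖f q‖ ≤ C * ν ^ n ∧ ‖g q‖ ≤ C * ν ^ n := by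
  obtain ⟨C₁, h₁⟩ := Asymptotics.isBigO_principal.1 hf
  obtain ⟨C₂, h₂⟩ := Asymptotics.isBigO_principal.1 hg
  refine ⟨max C₁ C₂, fun q ν hν hl hx hy => ?_⟩
  have hpos : 0 ≤ ν ^ n := pow_nonneg (by linarith) n
  have e₁ := h₁ (q, ν) ⟨hν, hl, hx, hy⟩
  have e₂ := h₂ (q, ν) ⟨hν, hl, hx, hy⟩
  rw [Real.norm_of_nonneg hpos] at e₁ e₂
  exact ⟨e₁.trans (mul_le_mul_of_nonneg_right (le_max_left _ _) hpos),
    e₂.trans (mul_le_mul_of_nonneg_right (le_max_right _ _) hpos)⟩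

section Weighted

variable {D : ℕ}

theorem one_le_weightedSet : ∀ᶠ a in 𝓟 (weightedSet D), 1 ≤ a.2 :=
  eventually_principal.2 fun _ ha => ha.1

theorem isBigO_of_norm_le_weightedSet {f : (ℂ × ℂ × ℂ) × ℝ → ℂ} {n : ℕ}
    (h : ∀ a ∈ weightedSet D, ‖f a‖ ≤ a.2 ^ n) :
    f =O[𝓟 (weightedSet D)] fun a => a.2 ^ n :=
  Asymptotics.isBigO_principal.2 ⟨1, fun a ha => by
    rw [one_mul]; exact (h a ha).trans (le_abs_self _)⟩

theorem isBigO_param_weightedSet (b : ℂ) :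
    (fun a : (ℂ × ℂ × ℂ) × ℝ => b * a.1.1) =O[𝓟 (weightedSet D)] fun a => a.2 := by
  refine Asymptotics.IsBigO.const_mul_left ?_ b
  simpa using isBigO_of_norm_le_weightedSet (f := fun a => a.1.1) (n := 1)
    fun a (ha : a ∈ weightedSet D) => by simpa using ha.2.1

end Weighted

namespace SkewHenon

variable (H : SkewHenon)

theorem degreeProd_centered : degreeProd H.centered.factors = H.fiberDegree :=
  degreeProd_recenterList _ _

theorem two_le_fiberDegree : 2 ≤ H.fiberDegree := two_le_degreeProd H.factors_ne_nil

/-- It lets the translation by the image of the origin be absorbed in the error. -/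
theorem totalDegree_le_weight : H.totalDegree ≤ (H.totalDegree + 1) * H.fiberDegree - 1 := by
  have h := H.two_le_fiberDegree
  have h1 : (H.totalDegree + 1) * 2 ≤ (H.totalDegree + 1) * H.fiberDegree :=
    Nat.mul_le_mul_left _ h
  omega

theorem exists_fiberMap_bound : ∃ κ : ℂ, κ ≠ 0 ∧ ∃ C : ℝ, ∀ (q : ℂ × ℂ × ℂ) (ν : ℝ), 1 ≤ ν →
    ‖q.1‖ ≤ ν → ‖q.2.1‖ ≤ ν ^ (H.totalDegree + 1) → ‖q.2.2‖ ≤ ν ^ (H.totalDegree + 1) →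
    ‖(H.fiberMap q.1 q.2).1‖ ≤ C * ν ^ ((H.totalDegree + 1) * H.fiberDegree - 1) ∧
      ‖(H.fiberMap q.1 q.2).2 - κ * q.2.2 ^ H.fiberDegree‖ ≤
        C * ν ^ ((H.totalDegree + 1) * H.fiberDegree - 1) := by
  have hν := one_le_weightedSet (D := H.totalDegree)
  have hℓ : (fun a : (ℂ × ℂ × ℂ) × ℝ => a.1.1) =O[𝓟 (weightedSet H.totalDegree)] fun a => a.2 := by
    simpa using isBigO_param_weightedSet (D := H.totalDegree) 1
  obtain ⟨κ, hκ, h1, h2⟩ := exists_henonComp_isBigO (z := fun a => a.1.2) hν hℓ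
    (isBigO_of_norm_le_weightedSet fun a ha => ha.2.2.2) H.centered.factors_ne_nil
    H.natDegree_coeff_centered_le (isBigO_of_norm_le_weightedSet fun a ha => ha.2.2.1)
    (by simpa using Asymptotics.isBigO_zero _ _)
  rw [degreeProd_centered] at h1 h2
  have hτ : ∀ q : ℂ[X], q.natDegree ≤ H.totalDegree →
      (fun a : (ℂ × ℂ × ℂ) × ℝ => q.eval a.1.1) =O[𝓟 (weightedSet H.totalDegree)]
        fun a => a.2 ^ ((H.totalDegree + 1) * H.fiberDegree - 1) := fun q hq =>
    isBigO_eval hν hℓ q (hq.trans H.totalDegree_le_weight)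
  refine ⟨κ, hκ, exists_bound_of_isBigO_weightedSet (f := fun q => (H.fiberMap q.1 q.2).1)
    (g := fun q => (H.fiberMap q.1 q.2).2 - κ * q.2.2 ^ H.fiberDegree) ?_ ?_⟩
  · refine (h1.add (hτ _ H.natDegree_originImage_le.1)).congr_left fun a => ?_
    rw [fiberMap_eq_centered]
    rfl
  · refine (h2.add (hτ _ H.natDegree_originImage_le.2)).congr_left fun a => ?_
    rw [fiberMap_eq_centered, Prod.snd_add, add_sub_right_comm]
    rfl

/-- After exchanging coordinates the inverse is again a composition of Hénon maps, in reverse order.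
The factor `b` is there because `H⁻¹` uses the fibre map at the parameter `c⁻¹ l`. -/
theorem exists_fiberInvMap_bound (b : ℂ) : ∃ κ : ℂ, κ ≠ 0 ∧ ∃ C : ℝ, ∀ (q : ℂ × ℂ × ℂ) (ν : ℝ),
    1 ≤ ν → ‖q.1‖ ≤ ν → ‖q.2.1‖ ≤ ν ^ (H.totalDegree + 1) → ‖q.2.2‖ ≤ ν ^ (H.totalDegree + 1) →
    ‖(H.fiberInvMap (b * q.1) q.2).2‖ ≤ C * ν ^ ((H.totalDegree + 1) * H.fiberDegree - 1) ∧
      ‖(H.fiberInvMap (b * q.1) q.2).1 - κ * q.2.1 ^ H.fiberDegree‖ ≤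
        C * ν ^ ((H.totalDegree + 1) * H.fiberDegree - 1) := by
  have hν := one_le_weightedSet (D := H.totalDegree)
  have hℓ := isBigO_param_weightedSet (D := H.totalDegree) b
  have hτ : ∀ q : ℂ[X], q.natDegree ≤ H.totalDegree →
      (fun a : (ℂ × ℂ × ℂ) × ℝ => q.eval (b * a.1.1)) =O[𝓟 (weightedSet H.totalDegree)]
        fun a => a.2 ^ H.totalDegree := fun q hq => isBigO_eval hν hℓ q hq
  set L := H.centered.factors.reverse.map HenonFactor.swapInv with hL
  obtain ⟨κ, hκ, h1, h2⟩ := exists_henonComp_isBigO (L := L)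
    (z := fun a => (a.1.2 - (H.originImage.1.eval (b * a.1.1),
      H.originImage.2.eval (b * a.1.1))).swap) hν hℓ
    (isBigO_of_norm_le_weightedSet fun a ha => ha.2.2.1)
    (by simpa [hL] using H.centered.factors_ne_nil)
    (by
      intro f hf k
      obtain ⟨g, hg, rfl⟩ := List.mem_map.1 hf
      exact (g.natDegree_coeff_swapInv_le k).trans
        (H.natDegree_coeff_centered_le g (List.mem_reverse.1 hg) k))
    ((isBigO_of_norm_le_weightedSet fun a ha => ha.2.2.2).sub
      ((hτ _ H.natDegree_originImage_le.2).trans (isBigO_pow_of_le hν (Nat.le_succ _))))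
    -- The translation is now applied before the maps and perturbs the leading coordinate by weight
    -- at most `d̃`, one less than its own weight.
    ((hτ _ H.natDegree_originImage_le.1).neg_left.congr_left fun a => by simp)
  rw [hL, degreeProd_reverse_swapInv, degreeProd_centered] at h1 h2
  simp only [henonComp_reverse_swapInv] at h1 h2
  refine ⟨κ, hκ, exists_bound_of_isBigO_weightedSet
    (f := fun q => (H.fiberInvMap (b * q.1) q.2).2)
    (g := fun q => (H.fiberInvMap (b * q.1) q.2).1 - κ * q.2.1 ^ H.fiberDegree) ?_ ?_⟩
  · refine h1.congr_left fun a => ?_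
    rw [fiberInvMap_eq_centered]
    rfl
  · refine h2.congr_left fun a => ?_
    rw [fiberInvMap_eq_centered]
    rfl

theorem contDiff_toPerm {n : WithTop ℕ∞} : ContDiff ℂ n H.toPerm :=
  (contDiff_const.mul contDiff_fst).prodMk (contDiff_henonComp contDiff_fst contDiff_snd H.factors)

theorem contDiff_toPerm_inv {n : WithTop ℕ∞} : ContDiff ℂ n (H.toPerm⁻¹ : Equiv.Perm _) := by
  have hℓ : ContDiff ℂ n fun q : ℂ × ℂ × ℂ => H.c⁻¹ * q.1 := contDiff_const.mul contDiff_fst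
  have hz : ContDiff ℂ n fun q : ℂ × ℂ × ℂ => q.2.swap :=
    contDiff_snd.snd.prodMk contDiff_snd.fst
  have h := contDiff_henonComp hℓ hz (H.factors.reverse.map HenonFactor.swapInv)
  simp only [henonComp_reverse_swapInv] at h
  exact hℓ.prodMk (h.snd.prodMk h.fst)

/-- The projection to the coordinate `x`. -/
def coordX : ℂ × ℂ × ℂ →L[ℂ] ℂ :=
  (ContinuousLinearMap.fst ℂ ℂ ℂ).comp (ContinuousLinearMap.snd ℂ ℂ (ℂ × ℂ))

/-- The projection to the coordinate `y`. -/
def coordY : ℂ × ℂ × ℂ →L[ℂ] ℂ :=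
  (ContinuousLinearMap.snd ℂ ℂ ℂ).comp (ContinuousLinearMap.snd ℂ ℂ (ℂ × ℂ))

theorem exists_escapeSystem : ∃ S : EscapeSystem, S.F = H.toPerm ∧ S.d = H.fiberDegree ∧
    ∀ R, S.V R = H.VPlus R := by
  obtain ⟨κ, hκ, C, h⟩ := H.exists_fiberMap_bound
  obtain ⟨κ', hκ', C', h'⟩ := H.exists_fiberInvMap_bound H.c⁻¹
  have hle : ∀ {a b ν : ℝ} (n : ℕ), 1 ≤ ν → a ≤ b → a * ν ^ n ≤ b * ν ^ n := fun n hν hab =>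
    mul_le_mul_of_nonneg_right hab (pow_nonneg (by linarith) n)
  exact ⟨{
    F := H.toPerm
    X := coordX
    Y := coordY
    c := H.c
    κ := κ
    κ' := κ'
    C := max C C'
    D := H.totalDegree
    d := H.fiberDegree
    κ_ne_zero := hκ
    κ'_ne_zero := hκ'
    two_le_d := H.two_le_fiberDegree
    contDiff_F := H.contDiff_toPerm
    euclideanNorm_eq := fun _ => rfl
    fst_F := fun _ => rfl
    norm_Y_F_sub_le := fun q ν hν hl hx hy =>
      (h q ν hν hl hx hy).2.trans (hle _ hν (le_max_left _ _))
    norm_X_F_le := fun q ν hν hl hx hy =>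
      (h q ν hν hl hx hy).1.trans (hle _ hν (le_max_left _ _))
    norm_X_inv_sub_le := fun q ν hν hl hx hy =>
      (h' q ν hν hl hx hy).2.trans (hle _ hν (le_max_right _ _)) }, rfl, rfl, fun _ => rfl⟩

theorem exists_escapeSystem_inv : ∃ S : EscapeSystem, S.F = H.toPerm⁻¹ ∧ S.d = H.fiberDegree ∧
    ∀ R, S.V R = H.VMinus R := by
  obtain ⟨κ, hκ, C, h⟩ := H.exists_fiberMap_bound
  obtain ⟨κ', hκ', C', h'⟩ := H.exists_fiberInvMap_bound H.c⁻¹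
  have hle : ∀ {a b ν : ℝ} (n : ℕ), 1 ≤ ν → a ≤ b → a * ν ^ n ≤ b * ν ^ n := fun n hν hab =>
    mul_le_mul_of_nonneg_right hab (pow_nonneg (by linarith) n)
  -- For `H⁻¹` the coordinates and the constants `κ`, `κ'` change roles, and the multiplier becomes
  -- `c⁻¹`.
  refine ⟨{
    F := H.toPerm⁻¹
    X := coordY
    Y := coordX
    c := H.c⁻¹
    κ := κ'
    κ' := κ
    C := max C C'
    D := H.totalDegree
    d := H.fiberDegree
    κ_ne_zero := hκ'
    κ'_ne_zero := hκ
    two_le_d := H.two_le_fiberDegree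
    contDiff_F := H.contDiff_toPerm_inv
    euclideanNorm_eq := fun q => by
      rw [euclideanNorm, add_right_comm]
      rfl
    fst_F := fun _ => rfl
    norm_Y_F_sub_le := fun q ν hν hl hy hx =>
      (h' q ν hν hl hx hy).2.trans (hle _ hν (le_max_right _ _))
    norm_X_F_le := fun q ν hν hl hy hx =>
      (h' q ν hν hl hx hy).1.trans (hle _ hν (le_max_right _ _))
    norm_X_inv_sub_le := fun q ν hν hl hy hx => by
      rw [inv_inv]
      exact (h q ν hν hl hx hy).2.trans (hle _ hν (le_max_left _ _)) }, rfl, rfl, fun R => ?_⟩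
  have hc : 1 ≤ ‖H.c⁻¹‖ ↔ ‖H.c‖ ≤ 1 := by
    rw [norm_inv, one_le_inv₀ (norm_pos_iff.2 H.c_ne_zero)]
  unfold EscapeSystem.V VMinus
  simp only [hc]
  rfl

theorem iUnion_image_inv_pow_eq (F : Equiv.Perm (ℂ × ℂ × ℂ)) (V : Set (ℂ × ℂ × ℂ)) :
    (⋃ n ∈ Set.Ici (1 : ℕ), (fun q => (F⁻¹ ^ n) q) '' V) = {q | ∃ n ≥ 1, (F ^ n) q ∈ V} := by
  ext q
  simp only [Set.mem_iUnion, Set.mem_Ici, Set.mem_image, Set.mem_ofPred_eq, exists_prop]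
  refine exists_congr fun n => and_congr_right fun _ => ⟨?_, fun h => ⟨_, h, ?_⟩⟩
  · rintro ⟨p, hp, rfl⟩
    rw [inv_pow]
    simpa using hp
  · rw [inv_pow]
    simp

/-- The given normalization differs from `d⁻ⁿ` by the constant factor `d / d̃`. -/
theorem normalization_eq {N d : ℝ} (hd : d ≠ 0) {n : ℕ} (hn : 1 ≤ n) (t : ℝ) :
    1 / (N * d ^ (n - 1)) * t = d / N * (t / d ^ n) := by
  obtain ⟨m, rfl⟩ := Nat.exists_eq_add_of_le' hn
  rw [Nat.add_sub_cancel, pow_succ]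
  field_simp

end SkewHenon

end

/-! ### The main theorem -/

theorem mainTheorem5 (H : SkewHenon) :
    ∃ R₀ : ℝ, ∀ R ≥ R₀,
      ((∀ Q : Set (ℂ × ℂ × ℂ), IsCompact Q →
          TendstoUniformlyOn H.greenSeqPlus H.greenPlus atTop Q) ∧
        IsPlurisubharmonicOn H.greenPlus Set.univ ∧
        IsOpen (H.KPlus R)ᶜ ∧
        IsPluriharmonicOn H.greenPlus (H.KPlus R)ᶜ ∧
        (∀ q, H.greenPlus (H.toPerm q) = (H.fiberDegree : ℝ) * H.greenPlus q) ∧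
        (∀ q ∈ H.UPlus R, 0 < H.greenPlus q) ∧
        (∀ q, H.greenPlus q = 0 ↔ q ∈ H.KPlus R)) ∧
      ((∀ Q : Set (ℂ × ℂ × ℂ), IsCompact Q →
          TendstoUniformlyOn H.greenSeqMinus H.greenMinus atTop Q) ∧
        IsPlurisubharmonicOn H.greenMinus Set.univ ∧
        IsOpen (H.KMinus R)ᶜ ∧
        IsPluriharmonicOn H.greenMinus (H.KMinus R)ᶜ ∧
        (∀ q, H.greenMinus (H.toPerm⁻¹ q) = (H.fiberDegree : ℝ) * H.greenMinus q) ∧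
        (∀ q ∈ H.UMinus R, 0 < H.greenMinus q) ∧
        (∀ q, H.greenMinus q = 0 ↔ q ∈ H.KMinus R)) := by
  obtain ⟨S, hF, hd, hV⟩ := H.exists_escapeSystem
  obtain ⟨S', hF', hd', hV'⟩ := H.exists_escapeSystem_inv
  have hd0 : (H.fiberDegree : ℝ) ≠ 0 := by
    have := H.two_le_fiberDegree
    exact_mod_cast (by omega : H.fiberDegree ≠ 0)
  have hs : 0 < (H.fiberDegree : ℝ) / H.totalDegree := by
    have h1 := H.two_le_fiberDegree
    have h2 := H.totalDegree_pos
    exact div_pos (by exact_mod_cast (by omega : 0 < H.fiberDegree)) (by exact_mod_cast h2)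
  have hU : ∀ R, H.UPlus R = S.U R := fun R => by
    rw [SkewHenon.UPlus, SkewHenon.iUnion_image_inv_pow_eq, EscapeSystem.U, hF, hV]
  have hU' : ∀ R, H.UMinus R = S'.U R := fun R => by
    have := SkewHenon.iUnion_image_inv_pow_eq H.toPerm⁻¹ (H.VMinus R)
    rw [inv_inv] at this
    rw [SkewHenon.UMinus, this, EscapeSystem.U, hF', hV']
  obtain ⟨R₁, h₁⟩ := S.exists_radius_green hs (g := H.greenSeqPlus) (G := H.greenPlus)
    (fun n hn q => by
      rw [EscapeSystem.growth, hF, hd]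
      exact SkewHenon.normalization_eq hd0 hn _) fun _ => rfl
  obtain ⟨R₂, h₂⟩ := S'.exists_radius_green hs (g := H.greenSeqMinus) (G := H.greenMinus)
    (fun n hn q => by
      rw [EscapeSystem.growth, hF', hd']
      exact SkewHenon.normalization_eq hd0 hn _) fun _ => rfl
  refine ⟨max R₁ R₂, fun R hR => ⟨?_, ?_⟩⟩
  · have h := h₁ R ((le_max_left _ _).trans hR)
    rw [hF, hd, ← hU] at h
    simpa only [SkewHenon.KPlus, compl_compl, Set.mem_compl_iff] using h
  · have h := h₂ R ((le_max_right _ _).trans hR)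
    rw [hF', hd', ← hU'] at h
    simpa only [SkewHenon.KMinus, compl_compl, Set.mem_compl_iff] using h
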